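/- Let $0<a<\infty$, put $p(t)=1-t^2/a^2$, and consider on $(-a,a)$ the differential expression $$(Lx)(t)=-\frac{d}{dt}\Big(p(t)\frac{dx(t)}{dt}\Big)+t^2x(t).$$ Let $\mathcal L_I$ be the operator in $L^2((-a,a))$ (complex-valued functions) given by $\mathcal L_Ix=Lx$ on the domain consisting of all $x\in L^2((-a,a))$ such that $x$ is differentiable at every point of $(-a,a)$, $x'$ is absolutely continuous on every compact subinterval of $(-a,a)$, $Lx\in L^2((-a,a))$, and $$\lim_{t\to-a+0}(t+a)\,x'(t)=0,\qquad \lim_{t\to a-0}(t-a)\,x'(t)=0 .$$ Then $\mathcal L_I$ is self-adjoint, and: 1. $\mathcal L_I$ has discrete spectrum: every point of its spectrum is an isolated point of the spectrum and an eigenvalue of finite multiplicity. 2. The spectrum of $\mathcal L_I$ is the set of members of a strictly increasing infinite sequence $\mu_0<\mu_1<\mu_2<\cdots$ of positive eigenvalues with $\mu_n\to+\infty$, each of multiplicity one. 3. A number $\lambda\in\mathbb C$ is an eigenvalue of $\mathcal L_I$ if and only if there is a twice differentiable function $e:(-a,a)\to\mathbb C$, not identically zero, such that $$-\frac{d}{dt}\Big(\Big(1-\frac{t^2}{a^2}\Big)\frac{de(t)}{dt}\Big)+t^2e(t)=\lambda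 e(t),\qquad -a<t<a,$$ and both limits $e(-a)=\lim_{t\to-a+0}e(t)$ and $e(a)=\lim_{t\to a-0}e(t)$ exist and are finite. Every such $e$ is an eigenvector of $\mathcal L_I$ corresponding to the eigenvalue $\lambda$. -/

import Mathlib

open Set Filter Topology MeasureTheory

noncomputable section

namespace Prolate

/-! ### Unbounded operators: resolvent set, spectrum, eigenspaces -/

section Abstract

variable {E : Type*} [NormedAddCommGroup E] [NormedSpace ℂ E]

/-- `z` is in the resolvent set of `A` if `A - z` maps the domain of `A` bijectively onto `E`
and the inverse is a bounded operator `R` on `E`. -/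
def resolventSet (A : E →ₗ.[ℂ] E) : Set ℂ :=
  {z | ∃ R : E →L[ℂ] E,
    (∀ f : E, ∃ h : R f ∈ A.domain, A ⟨R f, h⟩ - z • R f = f) ∧
    ∀ x : A.domain, R (A x - z • (x : E)) = x}

/-- The spectrum of an unbounded operator. -/
def spectrum (A : E →ₗ.[ℂ] E) : Set ℂ := (resolventSet A)ᶜ

/-- The eigenspace `{f ∈ dom A : A f = z f}`. -/
def eigenspace (A : E →ₗ.[ℂ] E) (z : ℂ) : Submodule ℂ E where
  carrier := {f | ∃ h : f ∈ A.domain, A ⟨f, h⟩ = z • f}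
  zero_mem' := ⟨A.domain.zero_mem, by
    rw [smul_zero]; exact A.map_zero⟩
  add_mem' := by
    rintro f g ⟨hf, hf'⟩ ⟨hg, hg'⟩
    refine ⟨A.domain.add_mem hf hg, ?_⟩
    have := A.map_add ⟨f, hf⟩ ⟨g, hg⟩
    rw [smul_add, ← hf', ← hg', ← this]
    rfl
  smul_mem' := by
    rintro c f ⟨hf, hf'⟩
    refine ⟨A.domain.smul_mem c hf, ?_⟩
    have := A.map_smul c ⟨f, hf⟩
    rw [smul_comm, ← hf', ← this]
    rfl

/-- `z` is an eigenvalue of `A`. -/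
def HasEigenvalue (A : E →ₗ.[ℂ] E) (z : ℂ) : Prop :=
  ∃ f ∈ eigenspace A z, f ≠ 0

/-- Discrete spectrum: every point of the spectrum is an isolated point of the spectrum and an
eigenvalue of finite multiplicity. -/
def HasDiscreteSpectrum (A : E →ₗ.[ℂ] E) : Prop :=
  ∀ z ∈ spectrum A,
    (∃ ε > 0, ∀ w ∈ spectrum A, dist w z < ε → w = z) ∧
    HasEigenvalue A z ∧ FiniteDimensional ℂ (eigenspace A z)

end Abstract

/-! ### The prolate spheroid differential expression and its maximal domain -/

/-- Lebesgue measure on the open interval `(-a, a)`. -/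
abbrev intervalMeasure (a : ℝ) : Measure ℝ := volume.restrict (Ioo (-a) a)

/-- The Hilbert space `L²((-a, a))` of complex-valued functions. -/
abbrev HilbertL2 (a : ℝ) : Type := Lp ℂ 2 (intervalMeasure a)

/-- `(p x')(t)`, where `p(t) = 1 - t² / a²`. -/
def flux (a : ℝ) (x : ℝ → ℂ) (t : ℝ) : ℂ := ((1 - t ^ 2 / a ^ 2 : ℝ) : ℂ) * deriv x t

/-- The formal differential operator `(L x)(t) = - (p x')'(t) + t² x(t)`. -/
def formalL (a : ℝ) (x : ℝ → ℂ) (t : ℝ) : ℂ :=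
  -deriv (flux a x) t + ((t ^ 2 : ℝ) : ℂ) * x t

/-- The functions that are differentiable at every point of `(-a, a)` and whose derivative is
absolutely continuous on every compact subinterval of `(-a, a)`. Functions are total, but only
their values on `(-a, a)` matter. -/
def classA (a : ℝ) : Set (ℝ → ℂ) :=
  {x | (∀ t ∈ Ioo (-a) a, DifferentiableAt ℝ x t) ∧
    ∀ α β : ℝ, -a < α → α ≤ β → β < a → AbsolutelyContinuousOnInterval (deriv x) α β}

/-- The domain of the maximal operator: `x ∈ L² ∩ A` with `L x ∈ L²`. -/
def domainMax (a : ℝ) : Set (ℝ → ℂ) :=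
  {x | x ∈ classA a ∧ MemLp x 2 (intervalMeasure a) ∧ MemLp (formalL a x) 2 (intervalMeasure a)}

/-- The domain of `L_I`: the functions `x` in the maximal domain whose generalized boundary values
`b_{-a}(x) = lim_{t → -a+0} (t + a) x'(t)` and `b_a(x) = lim_{t → a-0} (t - a) x'(t)` vanish. -/
def domainI (a : ℝ) : Set (ℝ → ℂ) :=
  {x | x ∈ domainMax a ∧
    Tendsto (fun t : ℝ => ((t + a : ℝ) : ℂ) * deriv x t) (𝓝[>] (-a)) (𝓝 0) ∧
    Tendsto (fun t : ℝ => ((t - a : ℝ) : ℂ) * deriv x t) (𝓝[<] a) (𝓝 0)}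

lemma ae_differentiableAt_deriv {a : ℝ} {x : ℝ → ℂ} (hx : x ∈ classA a) :
    ∀ᵐ t ∂(intervalMeasure a), DifferentiableAt ℝ (deriv x) t := by
  rw [ae_restrict_iff' measurableSet_Ioo]
  have key : ∀ n : ℕ, ∀ᵐ t : ℝ, t ∈ Ioo (-a + 1 / ((n : ℝ) + 1)) (a - 1 / ((n : ℝ) + 1)) →
      DifferentiableAt ℝ (deriv x) t := by
    intro n
    have hn : (0 : ℝ) < 1 / ((n : ℝ) + 1) := by positivity
    by_cases h : -a + 1 / ((n : ℝ) + 1) ≤ a - 1 / ((n : ℝ) + 1)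
    · have := (hx.2 _ _ (by linarith) h
        (by linarith)).boundedVariationOn.ae_differentiableAt_of_mem_uIcc
      filter_upwards [this] with t ht hmem
      exact ht (by rw [uIcc_of_le h]; exact Ioo_subset_Icc_self hmem)
    · exact ae_of_all _ fun t ht => absurd (ht.1.trans ht.2).le h
  rw [← ae_all_iff] at key
  filter_upwards [key] with t ht hmem
  obtain ⟨n, hn⟩ := exists_nat_one_div_lt
    (show (0 : ℝ) < min (t + a) (a - t) from lt_min (by linarith [hmem.1]) (by linarith [hmem.2]))
  have h1 := hn.trans_le (min_le_left _ _)
  have h2 := hn.trans_le (min_le_right _ _)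
  exact ht n ⟨by linarith, by linarith⟩

lemma differentiableAt_flux {a : ℝ} {x : ℝ → ℂ} {t : ℝ} (h : DifferentiableAt ℝ (deriv x) t) :
    DifferentiableAt ℝ (flux a x) t := by
  unfold flux
  refine DifferentiableAt.mul ?_ h
  have h1 : DifferentiableAt ℝ (fun s : ℝ => 1 - s ^ 2 / a ^ 2) t := by fun_prop
  exact Complex.ofRealCLM.differentiableAt.comp t h1

lemma formalL_add {a : ℝ} {x y : ℝ → ℂ} (hx : x ∈ classA a) (hy : y ∈ classA a) :
    formalL a (x + y) =ᵐ[intervalMeasure a] formalL a x + formalL a y := by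
  filter_upwards [ae_differentiableAt_deriv hx, ae_differentiableAt_deriv hy,
    ae_restrict_mem measurableSet_Ioo] with t h1 h2 ht
  have : flux a (x + y) =ᶠ[𝓝 t] flux a x + flux a y := by
    filter_upwards [isOpen_Ioo.mem_nhds ht] with s hs
    simp only [flux, Pi.add_apply, deriv_add (hx.1 s hs) (hy.1 s hs)]
    ring
  simp only [formalL, this.deriv_eq, Pi.add_apply,
    deriv_add (differentiableAt_flux (a := a) h1) (differentiableAt_flux (a := a) h2)]
  ring

lemma deriv_smul_fun (c : ℂ) (x : ℝ → ℂ) : deriv (c • x) = c • deriv x := by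
  ext t
  exact deriv_const_smul_field c x

lemma formalL_smul (a : ℝ) (c : ℂ) (x : ℝ → ℂ) : formalL a (c • x) = c • formalL a x := by
  have : flux a (c • x) = c • flux a x := by
    ext t
    simp only [flux, deriv_smul_fun, Pi.smul_apply, smul_eq_mul]
    ring
  ext t
  simp only [formalL, this, deriv_smul_fun, Pi.smul_apply, smul_eq_mul]
  ring

lemma zero_mem_domainI (a : ℝ) : (0 : ℝ → ℂ) ∈ domainI a := by
  have h0 : deriv (0 : ℝ → ℂ) = 0 := by ext t; exact deriv_const t 0
  have hL : formalL a 0 = 0 := by simpa using formalL_smul a 0 0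
  refine ⟨⟨⟨fun t _ => differentiableAt_const 0, fun α β _ _ _ => ?_⟩, MemLp.zero, ?_⟩, ?_, ?_⟩
  · rw [h0]
    exact (LipschitzWith.const (0 : ℂ)).lipschitzOnWith.absolutelyContinuousOnInterval
  · rw [hL]; exact MemLp.zero
  · simp [h0]
  · simp [h0]

lemma add_mem_domainI {a : ℝ} (ha : 0 < a) {x y : ℝ → ℂ} (hx : x ∈ domainI a)
    (hy : y ∈ domainI a) : x + y ∈ domainI a := by
  have hd : ∀ t ∈ Ioo (-a) a, deriv (x + y) t = deriv x t + deriv y t := fun t ht =>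
    deriv_add (hx.1.1.1 t ht) (hy.1.1.1 t ht)
  refine ⟨⟨⟨fun t ht => (hx.1.1.1 t ht).add (hy.1.1.1 t ht), fun α β h1 h2 h3 => ?_⟩,
    hx.1.2.1.add hy.1.2.1, ?_⟩, ?_, ?_⟩
  · have h := (hx.1.1.2 α β h1 h2 h3).add (hy.1.1.2 α β h1 h2 h3)
    rw [absolutelyContinuousOnInterval_iff] at h ⊢
    intro ε hε
    obtain ⟨δ, hδ, h⟩ := h ε hε
    refine ⟨δ, hδ, fun E hE hlen => ?_⟩
    refine lt_of_eq_of_lt (Finset.sum_congr rfl fun i hi => ?_) (h E hE hlen)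
    have hsub : ∀ t ∈ uIcc α β, t ∈ Ioo (-a) a := fun t ht => by
      rw [uIcc_of_le h2] at ht
      exact ⟨h1.trans_le ht.1, ht.2.trans_lt h3⟩
    rw [hd _ (hsub _ (hE.1 i hi).1), hd _ (hsub _ (hE.1 i hi).2)]
    rfl
  · exact (memLp_congr_ae (formalL_add hx.1.1 hy.1.1)).2 (hx.1.2.2.add hy.1.2.2)
  · have := hx.2.1.add hy.2.1
    rw [add_zero] at this
    refine this.congr' ?_
    filter_upwards [Ioo_mem_nhdsGT (show -a < a by linarith)] with t ht
    rw [hd t ht]; ring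
  · have := hx.2.2.add hy.2.2
    rw [add_zero] at this
    refine this.congr' ?_
    filter_upwards [Ioo_mem_nhdsLT (show -a < a by linarith)] with t ht
    rw [hd t ht]; ring

lemma smul_mem_domainI {a : ℝ} (c : ℂ) {x : ℝ → ℂ} (hx : x ∈ domainI a) :
    c • x ∈ domainI a := by
  refine ⟨⟨⟨fun t ht => (hx.1.1.1 t ht).const_smul c, fun α β h1 h2 h3 => ?_⟩,
    hx.1.2.1.const_smul c, ?_⟩, ?_, ?_⟩
  · rw [deriv_smul_fun]
    exact (hx.1.1.2 α β h1 h2 h3).const_smul c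
  · rw [formalL_smul]; exact hx.1.2.2.const_smul c
  · have := hx.2.1.const_mul c
    rw [mul_zero] at this
    refine this.congr fun t => ?_
    simp only [deriv_smul_fun, Pi.smul_apply, smul_eq_mul]; ring
  · have := hx.2.2.const_mul c
    rw [mul_zero] at this
    refine this.congr fun t => ?_
    simp only [deriv_smul_fun, Pi.smul_apply, smul_eq_mul]; ring

/-! ### The operator `L_I` -/

/-- The graph of `L_I` in `L² × L²`: the pairs of classes of `x` and `L x`, for `x` in the
domain of `L_I`. -/
def graphI (a : ℝ) (ha : 0 < a) : Submodule ℂ (HilbertL2 a × HilbertL2 a) where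
  carrier := {fg | ∃ x ∈ domainI a,
    (fg.1 : ℝ → ℂ) =ᵐ[intervalMeasure a] x ∧ (fg.2 : ℝ → ℂ) =ᵐ[intervalMeasure a] formalL a x}
  zero_mem' := by
    refine ⟨0, zero_mem_domainI a, Lp.coeFn_zero _ _ _, ?_⟩
    have hL : formalL a 0 = 0 := by simpa using formalL_smul a 0 0
    rw [hL]; exact Lp.coeFn_zero _ _ _
  add_mem' := by
    rintro ⟨f, g⟩ ⟨f', g'⟩ ⟨x, hx, hf, hg⟩ ⟨y, hy, hf', hg'⟩
    exact ⟨x + y, add_mem_domainI ha hx hy, (Lp.coeFn_add f f').trans (hf.add hf'),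
      ((Lp.coeFn_add g g').trans (hg.add hg')).trans (formalL_add hx.1.1 hy.1.1).symm⟩
  smul_mem' := by
    rintro c ⟨f, g⟩ ⟨x, hx, hf, hg⟩
    refine ⟨c • x, smul_mem_domainI c hx, (Lp.coeFn_smul c f).trans (hf.const_smul c), ?_⟩
    rw [formalL_smul]
    exact (Lp.coeFn_smul c g).trans (hg.const_smul c)

/-- The graph is single valued. -/
lemma graphI_snd_eq_zero (a : ℝ) (ha : 0 < a) (p : HilbertL2 a × HilbertL2 a)
    (hp : p ∈ graphI a ha) (h0 : p.1 = 0) : p.2 = 0 := by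
  obtain ⟨x, hx, hf, hg⟩ := hp
  have hx0 : x =ᵐ[intervalMeasure a] 0 := by
    refine hf.symm.trans ?_
    rw [h0]; exact Lp.coeFn_zero _ _ _
  have hcont : ContinuousOn x (Ioo (-a) a) := fun t ht =>
    (hx.1.1.1 t ht).continuousAt.continuousWithinAt
  have hz : EqOn x 0 (Ioo (-a) a) :=
    Measure.eqOn_open_of_ae_eq hx0 isOpen_Ioo hcont continuousOn_const
  have hL0 : formalL a x =ᵐ[intervalMeasure a] 0 := by
    filter_upwards [ae_restrict_mem measurableSet_Ioo] with t ht
    have hfl : flux a x =ᶠ[𝓝 t] fun _ => 0 := by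
      filter_upwards [isOpen_Ioo.mem_nhds ht] with s hs
      have : x =ᶠ[𝓝 s] fun _ => 0 := by
        filter_upwards [isOpen_Ioo.mem_nhds hs] with r hr
        exact hz hr
      simp [flux, this.deriv_eq]
    simp [formalL, hfl.deriv_eq, hz ht]
  exact Lp.ext ((hg.trans hL0).trans (Lp.coeFn_zero _ _ _).symm)

/-- The operator `L_I` in `L²((-a, a))`: `L_I x = L x` for `x` in the domain of `L_I`. -/
def operatorI (a : ℝ) (ha : 0 < a) : HilbertL2 a →ₗ.[ℂ] HilbertL2 a :=
  (graphI a ha).toLinearPMap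

/-- The operator `L_I` has the intended graph. -/
lemma operatorI_graph (a : ℝ) (ha : 0 < a) : (operatorI a ha).graph = graphI a ha :=
  Submodule.toLinearPMap_graph_eq _ (graphI_snd_eq_zero a ha)

/-! ### The boundary value problem -/

/-- `e` solves `L e = z e` on `(-a, a)` and has finite limits at both endpoints. -/
structure IsFiniteSolution (a : ℝ) (z : ℂ) (e : ℝ → ℂ) : Prop where
  differentiableAt : ∀ t ∈ Ioo (-a) a, DifferentiableAt ℝ e t
  differentiableAt_deriv : ∀ t ∈ Ioo (-a) a, DifferentiableAt ℝ (deriv e) t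
  equation : ∀ t ∈ Ioo (-a) a, formalL a e t = z * e t
  finite_left : ∃ c : ℂ, Tendsto e (𝓝[>] (-a)) (𝓝 c)
  finite_right : ∃ c : ℂ, Tendsto e (𝓝[<] a) (𝓝 c)

end Prolate

end

/-! The operator has a compact inverse and a strictly positive quadratic form. The rest is abstract:
such an inverse `R` is symmetric, the operator is self-adjoint, and `z` is an eigenvalue exactly
when `z⁻¹` is an eigenvalue of `R`. The Fredholm alternative leaves no spectrum besides eigenvalues.
Compactness prevents infinitely many eigenvalues below any bound, and the spectral theorem in an
infinite dimensional space prevents there being finitely many in all.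

The analysis rests on one reformulation. Since `p = (a + t)(a - t) / a²`, the boundary conditions
say that `p x'` vanishes at both ends. So `x` is in the domain exactly when `p x'` is the primitive
from `-a` of some `w ∈ L²` with total integral zero (`HasSource`). By Cauchy-Schwarz, started from
the nearer endpoint, `|x'|` is at most a multiple of `‖w‖` times `1/√(a+t) + 1/√(a-t)`, which is
integrable. Hence `x` is a Lipschitz function of the primitive `gauge`, with constant controlled by
`‖w‖`, and extends continuously to the closed interval. Boundary terms then vanish on integrating by
parts, and the form is `∫ p|x'|² + ∫ t²|x|²`, which is positive for `x ≠ 0`.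

For the inverse, let `P` be the mean and `S` the inverse of `x ↦ -(p x')' + P x`, compact by
Arzelà-Ascoli and the `gauge` modulus. As `S P = P`, the equation `L x = g` becomes `(1 - K) x = S
g` with `K = P - S t²` compact. Positivity excludes the eigenvalue `1` of `K`, so `1 - K` is
invertible and `R = (1 - K)⁻¹ S`.

Eigenvalues are simple because the Wronskian `p (x' y - y' x)` is constant and vanishes at `-a`.
Finally, a solution of the equation with finite limits satisfies the boundary conditions: `p x'` has
limits at the ends, and a nonzero limit would make `x` grow logarithmically. -/

namespace Prolate

/-! ### Spectral theory of operators with a compact inverse and positive form -/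

section Abstract

variable {H : Type*} [NormedAddCommGroup H] [InnerProductSpace ℂ H]

/-- `R` is a compact inverse of the unbounded operator `A`, and the quadratic form of `A` is
strictly positive. -/
structure IsPositiveCompactInverse (A : H →ₗ.[ℂ] H) (R : H →L[ℂ] H) : Prop where
  compact : IsCompactOperator R
  apply_inv : ∀ f, ∃ h : R f ∈ A.domain, A ⟨R f, h⟩ = f
  inv_apply : ∀ x : A.domain, R (A x) = x
  form_pos : ∀ x : A.domain, (x : H) ≠ 0 → ∃ r : ℝ, 0 < r ∧ inner ℂ (x : H) (A x) = r

namespace IsPositiveCompactInverse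

variable {A : H →ₗ.[ℂ] H} {R : H →L[ℂ] H}

lemma inv_injective (h : IsPositiveCompactInverse A R) : Function.Injective R := by
  refine (injective_iff_map_eq_zero R).2 fun f hf => ?_
  obtain ⟨hd, he⟩ := h.apply_inv f
  have : (⟨R f, hd⟩ : A.domain) = 0 := Subtype.ext hf
  rw [← he, this, A.map_zero]

/-- With `f = A (R f)`, the inner product of `R f` and `f` is a value of the form of `A`, hence
real; over `ℂ` a real quadratic form forces symmetry. -/
lemma inv_isSymmetric (h : IsPositiveCompactInverse A R) : R.IsSymmetric := by
  refine (LinearMap.isSymmetric_iff_inner_map_self_real _).2 fun f => ?_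
  obtain ⟨hd, he⟩ := h.apply_inv f
  by_cases h0 : R f = 0
  · simp [h0]
  · obtain ⟨r, -, hr⟩ := h.form_pos ⟨R f, hd⟩ h0
    rw [he] at hr
    simp only [ContinuousLinearMap.coe_coe] at hr ⊢
    rw [hr, Complex.conj_ofReal]

lemma mem_eigenspace_iff (h : IsPositiveCompactInverse A R) {z : ℂ} (hz : z ≠ 0) (f : H) :
    f ∈ eigenspace A z ↔ f ∈ Module.End.eigenspace (R : Module.End ℂ H) z⁻¹ := by
  rw [Module.End.mem_eigenspace_iff]
  constructor
  · rintro ⟨hf, hz'⟩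
    have := h.inv_apply ⟨f, hf⟩
    rw [hz', map_smul] at this
    simp only [ContinuousLinearMap.coe_coe] at this ⊢
    conv_rhs => rw [← this, smul_smul, inv_mul_cancel₀ hz, one_smul]
  · intro hf
    obtain ⟨hd, he⟩ := h.apply_inv (z • f)
    have : R (z • f) = f := by
      rw [map_smul]
      change z • (R : Module.End ℂ H) f = f
      rw [hf, smul_smul, mul_inv_cancel₀ hz, one_smul]
    exact ⟨this ▸ hd, by simpa only [this] using he⟩

lemma eigenvalue_pos (h : IsPositiveCompactInverse A R) {z : ℂ} (hz : HasEigenvalue A z) :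
    ∃ r : ℝ, 0 < r ∧ z = r := by
  obtain ⟨f, ⟨hf, he⟩, h0⟩ := hz
  obtain ⟨r, hr, hr'⟩ := h.form_pos ⟨f, hf⟩ h0
  rw [he, inner_smul_right, inner_self_eq_norm_sq_to_K] at hr'
  have hn : 0 < ‖f‖ := norm_pos_iff.2 h0
  refine ⟨r / ‖f‖ ^ 2, by positivity, ?_⟩
  have hne : (‖f‖ : ℂ) ≠ 0 := by exact_mod_cast hn.ne'
  push_cast
  rw [← hr']
  simp only [Complex.coe_algebraMap]
  field_simp

lemma hasEigenvalue_iff (h : IsPositiveCompactInverse A R) {z : ℂ} (hz : z ≠ 0) :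
    HasEigenvalue A z ↔ Module.End.HasEigenvalue (R : Module.End ℂ H) z⁻¹ := by
  constructor
  · rintro ⟨f, hf, h0⟩
    exact Module.End.hasEigenvalue_of_hasEigenvector ⟨(h.mem_eigenspace_iff hz f).1 hf, h0⟩
  · intro he
    obtain ⟨f, hf, h0⟩ := he.exists_hasEigenvector
    exact ⟨f, (h.mem_eigenspace_iff hz f).2 hf, h0⟩

lemma finiteDimensional_eigenspace [CompleteSpace H] (h : IsPositiveCompactInverse A R) {z : ℂ}
    (hz : z ≠ 0) : FiniteDimensional ℂ (eigenspace A z) := by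
  have : eigenspace A z = Module.End.eigenspace (R : Module.End ℂ H) z⁻¹ := by
    ext f
    exact h.mem_eigenspace_iff hz f
  rw [this]
  exact ContinuousLinearMap.finite_dimensional_eigenspace h.compact _ (inv_ne_zero hz)

/-- For `z ≠ 0`, on `x = R g` one has `(A - z) x = z (z⁻¹ - R) g`. If `z` is not an eigenvalue, the
Fredholm alternative inverts `z⁻¹ - R`; with inverse `S`, the resolvent is `z⁻¹ R S`. At `z = 0` the
resolvent is `R`. -/
lemma spectrum_eq [CompleteSpace H] (h : IsPositiveCompactInverse A R) :
    spectrum A = {z | HasEigenvalue A z} := by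
  ext z
  constructor
  · intro hz
    by_contra hne
    refine hz ?_
    by_cases h0 : z = 0
    · subst h0
      refine ⟨R, fun f => ?_, fun x => ?_⟩
      · obtain ⟨hd, he⟩ := h.apply_inv f
        exact ⟨hd, by rw [he, zero_smul, sub_zero]⟩
      · rw [zero_smul, sub_zero, h.inv_apply]
    have hu := (h.compact.hasEigenvalue_or_mem_resolventSet (inv_ne_zero h0)).resolve_left
      (fun hh => hne ((h.hasEigenvalue_iff h0).2 hh))
    rw [_root_.spectrum.mem_resolventSet_iff] at hu
    obtain ⟨u, hu⟩ := hu
    set S : H →L[ℂ] H := ((u⁻¹ : (H →L[ℂ] H)ˣ) : H →L[ℂ] H) with hS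
    have h1 : ∀ f, z⁻¹ • S f - R (S f) = f := fun f => by
      have := congrArg (fun B : H →L[ℂ] H => B f) u.mul_inv
      simpa [hu, Algebra.algebraMap_eq_smul_one, hS] using this
    have h2 : ∀ f, S (z⁻¹ • f - R f) = f := fun f => by
      have := congrArg (fun B : H →L[ℂ] H => B f) u.inv_mul
      simpa [hu, Algebra.algebraMap_eq_smul_one, hS] using this
    have h3 : ∀ f, R (S f) = S (R f) := fun f => by
      conv_rhs => rw [← h1 f, map_sub, map_smul, h2]
    refine ⟨z⁻¹ • (R ∘L S), fun f => ?_, fun x => ?_⟩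
    · obtain ⟨hd, he⟩ := h.apply_inv (S f)
      have hd' : z⁻¹ • R (S f) ∈ A.domain := A.domain.smul_mem _ hd
      refine ⟨hd', ?_⟩
      have : A ⟨z⁻¹ • R (S f), hd'⟩ = z⁻¹ • S f := by
        conv_rhs => rw [← he]
        exact A.map_smul z⁻¹ ⟨R (S f), hd⟩
      change A ⟨z⁻¹ • R (S f), hd'⟩ - z • z⁻¹ • R (S f) = f
      rw [this, smul_smul, mul_inv_cancel₀ h0, one_smul, h1]
    · change z⁻¹ • R (S (A x - z • (x : H))) = x
      rw [h3, map_sub, map_smul, h.inv_apply, ← map_smul, smul_sub, smul_smul,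
        inv_mul_cancel₀ h0, one_smul]
      conv_rhs => rw [← h2 x]
  · rintro ⟨f, ⟨hf, he⟩, h0⟩ ⟨S, -, hS⟩
    have := hS ⟨f, hf⟩
    rw [he, sub_self, map_zero] at this
    exact h0 this.symm

/-- A vector orthogonal to the range of `R` is killed by `R`, by symmetry, and `R` is injective. -/
lemma dense_domain [CompleteSpace H] (h : IsPositiveCompactInverse A R) :
    Dense (A.domain : Set H) := by
  rw [Submodule.dense_iff_topologicalClosure_eq_top,
    Submodule.topologicalClosure_eq_top_iff, Submodule.eq_bot_iff]
  intro f hf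
  refine h.inv_injective ?_
  rw [map_zero]
  refine ext_inner_left ℂ fun g => ?_
  rw [inner_zero_right]
  have := (Submodule.mem_orthogonal _ _).1 hf (R g) (h.apply_inv g).1
  rw [← this]
  exact (h.inv_isSymmetric g f).symm

/-- Symmetry of `R` gives `A ≤ A.adjoint`. Conversely, testing `y` in the adjoint domain against `f
= A (R f)` yields `y = R (A.adjoint y)`, which lies in the domain of `A`. -/
lemma isSelfAdjoint [CompleteSpace H] (h : IsPositiveCompactInverse A R) : IsSelfAdjoint A := by
  have hsymm : A.IsFormalAdjoint A := fun x y => by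
    conv_lhs => rw [← h.inv_apply y]
    conv_rhs => rw [← h.inv_apply x]
    exact (h.inv_isSymmetric (A x) (A y)).symm
  have hle := hsymm.le_adjoint h.dense_domain
  rw [LinearPMap.isSelfAdjoint_def]
  refine (LinearPMap.eq_of_le_of_domain_eq hle (le_antisymm hle.1 fun y hy => ?_)).symm
  have key : y = R (A.adjoint ⟨y, hy⟩) := by
    refine ext_inner_right ℂ fun f => ?_
    obtain ⟨hd, he⟩ := h.apply_inv f
    have h1 := LinearPMap.adjoint_isFormalAdjoint h.dense_domain ⟨y, hy⟩ ⟨R f, hd⟩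
    rw [he] at h1
    exact h1.symm.trans (h.inv_isSymmetric _ _).symm
  rw [key]
  exact (h.apply_inv _).1

lemma eigenvectors_orthogonal (h : IsPositiveCompactInverse A R) {r s : ℝ} (hr : 0 < r)
    (hs : 0 < s) (hrs : r ≠ s) {f g : H} (hf : f ∈ eigenspace A r) (hg : g ∈ eigenspace A s) :
    inner ℂ f g = 0 := by
  have hr' : (r : ℂ) ≠ 0 := by exact_mod_cast hr.ne'
  have hs' : (s : ℂ) ≠ 0 := by exact_mod_cast hs.ne'
  have h1 := (h.mem_eigenspace_iff hr' f).1 hf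
  have h2 := (h.mem_eigenspace_iff hs' g).1 hg
  exact h.inv_isSymmetric.orthogonalFamily_eigenspaces (i := (r : ℂ)⁻¹) (j := (s : ℂ)⁻¹)
    (fun he => hrs (by exact_mod_cast inv_inj.1 he)) ⟨f, h1⟩ ⟨g, h2⟩

/-- Infinitely many eigenvalues below `M` would give orthonormal eigenvectors whose images under `R`
are orthogonal of norm at least `M⁻¹`; such images have no Cauchy subsequence, against compactness.
-/
lemma finite_eigenvalues_le (h : IsPositiveCompactInverse A R) (M : ℝ) :
    ({r : ℝ | HasEigenvalue A r} ∩ Iic M).Finite := by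
  by_contra hinf
  have : Infinite ↥({r : ℝ | HasEigenvalue A r} ∩ Iic M) := Set.infinite_coe_iff.2 hinf
  let ν := Infinite.natEmbedding ↥({r : ℝ | HasEigenvalue A r} ∩ Iic M)
  have hν : ∀ n, 0 < (ν n : ℝ) := fun n => by
    obtain ⟨r, hr, hr'⟩ := h.eigenvalue_pos (ν n).2.1
    rw [Complex.ofReal_injective hr']
    exact hr
  have hM : 0 < M := (hν 0).trans_le (ν 0).2.2
  have hex : ∀ n, ∃ e ∈ eigenspace A (ν n : ℝ), ‖e‖ = 1 := fun n => by
    obtain ⟨f, hf, h0⟩ := (ν n).2.1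
    refine ⟨(‖f‖⁻¹ : ℂ) • f, Submodule.smul_mem _ _ hf, ?_⟩
    exact norm_smul_inv_norm h0
  choose e he hnorm using hex
  have hRe : ∀ n, R (e n) = ((ν n : ℝ) : ℂ)⁻¹ • e n := fun n => by
    have hne : ((ν n : ℝ) : ℂ) ≠ 0 := by exact_mod_cast (hν n).ne'
    exact Module.End.mem_eigenspace_iff.1 ((h.mem_eigenspace_iff hne _).1 (he n))
  have hsep : ∀ m n, m ≠ n → M⁻¹ ≤ ‖R (e m) - R (e n)‖ := fun m n hmn => by
    have horth : inner ℂ (R (e m)) (R (e n)) = 0 := by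
      rw [hRe, hRe, inner_smul_left, inner_smul_right,
        h.eigenvectors_orthogonal (hν m) (hν n)
          (fun hh => hmn (ν.injective (Subtype.ext hh))) (he m) (he n)]
      simp
    have h1 : ‖R (e m) - R (e n)‖ ^ 2 = ‖R (e m)‖ ^ 2 + ‖R (e n)‖ ^ 2 := by
      rw [@norm_sub_sq ℂ, horth]
      simp
    have h2 : M⁻¹ ≤ ‖R (e m)‖ := by
      rw [hRe, norm_smul, hnorm, mul_one, norm_inv, Complex.norm_real,
        Real.norm_of_nonneg (hν m).le]
      exact inv_anti₀ (hν m) (ν m).2.2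
    refine h2.trans (abs_le_of_sq_le_sq' ?_ (norm_nonneg _)).2
    rw [h1]
    exact le_add_of_nonneg_right (sq_nonneg _)
  obtain ⟨K, hK, hK'⟩ := h.compact.image_closedBall_subset_compact (f := (R : H →ₗ[ℂ] H)) 1
  obtain ⟨y, -, ψ, hψ, hψy⟩ := hK.tendsto_subseq
    (fun n => hK' ⟨e n, by simp [hnorm], rfl⟩)
  have hc := hψy.cauchySeq
  rw [Metric.cauchySeq_iff'] at hc
  obtain ⟨N, hN⟩ := hc M⁻¹ (by positivity)
  have h3 := hN (N + 1) (Nat.le_succ N)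
  rw [dist_eq_norm] at h3
  exact absurd h3 (not_lt.2 (hsep _ _ fun hh => by
    have := hψ.injective hh
    omega))

/-- Eigenspaces are finite dimensional, so finitely many of them span a finite dimensional `V`. By
the spectral theorem for `R` the complement of `V` is trivial, so `V` would be the whole space. -/
lemma infinite_eigenvalues [CompleteSpace H] (h : IsPositiveCompactInverse A R)
    (hH : ¬ FiniteDimensional ℂ H) : {r : ℝ | HasEigenvalue A r}.Infinite := by
  intro hfin
  refine hH ?_
  set V : Submodule ℂ H := ⨆ r ∈ {r : ℝ | HasEigenvalue A r}, eigenspace A r with hV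
  have hVfin : FiniteDimensional ℂ V := by
    have := hfin.to_subtype
    rw [hV, iSup_subtype']
    have : ∀ r : {r : ℝ | HasEigenvalue A r}, FiniteDimensional ℂ (eigenspace A (r : ℝ)) :=
      fun r => h.finiteDimensional_eigenspace (by
        obtain ⟨s, hs, hs'⟩ := h.eigenvalue_pos r.2
        rw [hs']
        exact_mod_cast hs.ne')
    exact Submodule.finiteDimensional_iSup _
  have hle : ⨆ μ, Module.End.eigenspace (R : Module.End ℂ H) μ ≤ V := by
    refine iSup_le fun μ => ?_
    by_cases hμ : Module.End.HasEigenvalue (R : Module.End ℂ H) μ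
    · have hμ0 : μ ≠ 0 := by
        rintro rfl
        obtain ⟨f, hf, h0⟩ := hμ.exists_hasEigenvector
        rw [Module.End.mem_eigenspace_iff, zero_smul] at hf
        exact h0 (h.inv_injective (hf.trans (map_zero R).symm))
      have he : HasEigenvalue A μ⁻¹ :=
        (h.hasEigenvalue_iff (inv_ne_zero hμ0)).2 (by rwa [inv_inv])
      obtain ⟨r, -, hr⟩ := h.eigenvalue_pos he
      intro f hf
      have hf' : f ∈ eigenspace A (r : ℂ) := by
        rw [← hr]
        exact (h.mem_eigenspace_iff (inv_ne_zero hμ0) f).2 (by rwa [inv_inv])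
      rw [hr] at he
      exact Submodule.mem_iSup_of_mem r (Submodule.mem_iSup_of_mem he hf')
    · rw [Module.End.hasEigenvalue_iff, not_not] at hμ
      rw [hμ]
      exact bot_le
  have hbot : Vᗮ = ⊥ := by
    rw [eq_bot_iff, ← ContinuousLinearMap.orthogonalComplement_iSup_eigenspaces_eq_bot h.compact
      h.inv_isSymmetric]
    exact Submodule.orthogonal_le hle
  have htop : V = ⊤ := Submodule.orthogonal_eq_bot_iff.1 hbot
  rw [htop] at hVfin
  exact Module.Finite.equiv Submodule.topEquiv

lemma hasDiscreteSpectrum [CompleteSpace H] (h : IsPositiveCompactInverse A R) :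
    HasDiscreteSpectrum A := by
  intro z hz
  have hspec := h.spectrum_eq
  have hz' : HasEigenvalue A z := by rwa [hspec] at hz
  obtain ⟨r, hr, rfl⟩ := h.eigenvalue_pos hz'
  refine ⟨?_, hz', h.finiteDimensional_eigenspace (by exact_mod_cast hr.ne')⟩
  have hfin := (h.finite_eigenvalues_le (r + 1)).subset
    (show ({s : ℝ | HasEigenvalue A s} ∩ Iic (r + 1)) \ {r} ⊆ _ from sdiff_subset)
  obtain ⟨ε, hε, hball⟩ := Metric.isOpen_iff.1 hfin.isClosed.isOpen_compl r (by simp)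
  -- The bound `1` keeps `w` below `r + 1`, where only finitely many eigenvalues lie.
  refine ⟨min ε 1, by positivity, fun w hw hd => ?_⟩
  rw [hspec] at hw
  obtain ⟨s, -, rfl⟩ := h.eigenvalue_pos hw
  rw [dist_eq_norm, ← Complex.ofReal_sub, Complex.norm_real, Real.norm_eq_abs] at hd
  by_contra hne
  have h1 : s ∈ Metric.ball r ε := by
    rw [Metric.mem_ball, Real.dist_eq]
    exact hd.trans_le (min_le_left _ _)
  refine hball h1 ⟨⟨hw, ?_⟩, fun hh => hne (by rw [mem_singleton_iff.1 hh])⟩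
  have := (abs_lt.1 (hd.trans_le (min_le_right _ _))).2
  rw [mem_Iic]
  linarith

end IsPositiveCompactInverse

end Abstract

/-! ### Enumeration of a locally finite set of reals -/

/-- A locally finite infinite set of reals which is bounded below is the range of a strictly
increasing sequence tending to infinity. -/
lemma exists_strictMono_range_eq {S : Set ℝ} (hinf : S.Infinite)
    (hfin : ∀ M, (S ∩ Iic M).Finite) :
    ∃ μ : ℕ → ℝ, StrictMono μ ∧ range μ = S ∧ Tendsto μ atTop atTop := by
  classical
  -- A locally finite linear order with a bottom and no maximum is order isomorphic to `ℕ`; the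
  -- instances below supply these properties for `S`.
  let _ : LocallyFiniteOrder S := LocallyFiniteOrder.ofFiniteIcc fun x y => by
    refine Set.Finite.of_finite_image ((hfin y).subset ?_) Subtype.val_injective.injOn
    rintro _ ⟨s, hs, rfl⟩
    exact ⟨s.2, hs.2⟩
  have hne : S.Nonempty := hinf.nonempty
  obtain ⟨s₀, hs₀⟩ := hne
  obtain ⟨b, hb, hmin⟩ := (hfin s₀).exists_minimalFor id _ ⟨s₀, hs₀, mem_Iic.2 le_rfl⟩
  let _ : OrderBot S :=
    { bot := ⟨b, hb.1⟩
      bot_le := fun s => by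
        rcases le_total (s : ℝ) b with hs | hs
        · exact hmin ⟨s.2, hs.trans hb.2⟩ hs
        · exact hs }
  have _ : NoMaxOrder S := ⟨fun s => by
    by_contra hcon
    push Not at hcon
    refine hinf ((hfin s).subset fun t ht => ⟨ht, hcon ⟨t, ht⟩⟩)⟩
  let _ := LinearLocallyFiniteOrder.succOrder S
  let _ := LinearLocallyFiniteOrder.predOrder S
  let e : S ≃o ℕ := orderIsoNatOfLinearSuccPredArch
  have hmono : StrictMono fun n => (e.symm n : ℝ) := fun m n hmn => e.symm.strictMono hmn
  refine ⟨fun n => e.symm n, hmono, ?_, ?_⟩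
  · ext s
    constructor
    · rintro ⟨n, rfl⟩
      exact (e.symm n).2
    · intro hs
      exact ⟨e ⟨s, hs⟩, by simp⟩
  · refine tendsto_atTop.2 fun M => ?_
    rw [← Nat.cofinite_eq_atTop]
    refine Set.Finite.of_finite_image ((hfin M).subset ?_) hmono.injective.injOn
    rintro _ ⟨n, hn, rfl⟩
    exact ⟨(e.symm n).2, le_of_lt (not_le.1 (show ¬ M ≤ (e.symm n : ℝ) from hn))⟩

/-! ### Absolute continuity of complex valued functions -/

section AbsolutelyContinuous

lemma absolutelyContinuousOnInterval_congr {f g : ℝ → ℂ} {α β : ℝ}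
    (hf : AbsolutelyContinuousOnInterval f α β) (h : EqOn f g (uIcc α β)) :
    AbsolutelyContinuousOnInterval g α β := by
  rw [absolutelyContinuousOnInterval_iff] at hf ⊢
  intro ε hε
  obtain ⟨δ, hδ, hf⟩ := hf ε hε
  refine ⟨δ, hδ, fun E hE hlen => ?_⟩
  refine lt_of_eq_of_lt (Finset.sum_congr rfl fun i hi => ?_) (hf E hE hlen)
  rw [h (hE.1 i hi).1, h (hE.1 i hi).2]

/-- The real valued case handles real and imaginary parts, recombined by multiplying with the
constants `1` and `Complex.I`. -/
lemma absolutelyContinuousOnInterval_integral {f : ℝ → ℂ} {α β c : ℝ}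
    (hf : IntervalIntegrable f volume α β) (hc : c ∈ uIcc α β) :
    AbsolutelyContinuousOnInterval (fun t => ∫ s in c..t, f s) α β := by
  have hre : IntervalIntegrable (fun s => (f s).re) volume α β := ⟨hf.1.re, hf.2.re⟩
  have him : IntervalIntegrable (fun s => (f s).im) volume α β := ⟨hf.1.im, hf.2.im⟩
  have hconst : ∀ z : ℂ, AbsolutelyContinuousOnInterval (fun _ : ℝ => z) α β := fun z =>
    (LipschitzWith.const z).lipschitzOnWith.absolutelyContinuousOnInterval
  have h1 := (hre.absolutelyContinuousOnInterval_intervalIntegral hc).fun_smul (hconst 1)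
  have h2 := (him.absolutelyContinuousOnInterval_intervalIntegral hc).fun_smul (hconst Complex.I)
  refine absolutelyContinuousOnInterval_congr (h1.add h2) fun t ht => ?_
  have hi : IntervalIntegrable f volume c t := hf.mono_set (uIcc_subset_uIcc hc ht)
  apply Complex.ext
  · have := Complex.reCLM.intervalIntegral_comp_comm hi
    simpa using this
  · have := Complex.imCLM.intervalIntegral_comp_comm hi
    simpa using this

/-- Fundamental theorem of calculus for complex valued absolutely continuous functions. -/
lemma integral_eq_sub_of_absolutelyContinuous {f f' : ℝ → ℂ} {α β : ℝ}
    (hf : AbsolutelyContinuousOnInterval f α β) (hf' : IntervalIntegrable f' volume α β)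
    (h : ∀ᵐ t, t ∈ uIcc α β → HasDerivAt f (f' t) t) :
    ∫ t in α..β, f' t = f β - f α := by
  -- `f` minus the primitive of `f'` is absolutely continuous with derivative zero a.e., hence
  -- constant.
  have hac := hf.sub (absolutelyContinuousOnInterval_integral hf' left_mem_uIcc)
  obtain ⟨C, hC⟩ := hac.const_of_ae_hasDerivAt_zero (by
    filter_upwards [h, hf'.ae_hasDerivAt_integral] with t h1 h2 ht
    simpa using (h1 ht).sub (h2 ht α left_mem_uIcc))
  have h1 := hC α left_mem_uIcc
  have h2 := hC β right_mem_uIcc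
  simp only [Pi.sub_apply, intervalIntegral.integral_same, sub_zero] at h1 h2
  rw [h1, ← h2]
  ring

end AbsolutelyContinuous

/-! ### The domain described by sources -/

variable {a : ℝ} {x y w v : ℝ → ℂ} {z : ℂ}

lemma one_sub_div_pos {t : ℝ} (ht : t ∈ Ioo (-a) a) : 0 < 1 - t ^ 2 / a ^ 2 := by
  have ha : 0 < a := by linarith [ht.1, ht.2]
  rw [sub_pos, div_lt_one (by positivity)]
  nlinarith [ht.1, ht.2]

lemma coe_one_sub_div_ne_zero {t : ℝ} (ht : t ∈ Ioo (-a) a) :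
    ((1 - t ^ 2 / a ^ 2 : ℝ) : ℂ) ≠ 0 :=
  Complex.ofReal_ne_zero.2 (one_sub_div_pos ht).ne'

lemma intervalIntegrable_of_memLp (hw : MemLp w 2 (intervalMeasure a)) (ha : 0 < a) :
    IntervalIntegrable w volume (-a) a := by
  rw [intervalIntegrable_iff_integrableOn_Ioo_of_le (by linarith)]
  exact hw.integrable (by norm_num)

lemma continuousOn_integral (ha : 0 < a) (hw : IntervalIntegrable w volume (-a) a) :
    ContinuousOn (fun t => ∫ s in (-a)..t, w s) (Icc (-a) a) := by
  have := intervalIntegral.continuousOn_primitive_interval' hw left_mem_uIcc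
  rwa [uIcc_of_le (by linarith)] at this

lemma tendsto_integral_left (ha : 0 < a) (hw : IntervalIntegrable w volume (-a) a) :
    Tendsto (fun t => ∫ s in (-a)..t, w s) (𝓝[>] (-a)) (𝓝 0) := by
  have := continuousOn_integral ha hw (-a) ⟨le_rfl, by linarith⟩
  rw [ContinuousWithinAt, intervalIntegral.integral_same] at this
  refine this.mono_left ?_
  rw [← nhdsWithin_Ioo_eq_nhdsGT (show -a < a by linarith)]
  exact nhdsWithin_mono _ Ioo_subset_Icc_self

lemma tendsto_integral_right (ha : 0 < a) (hw : IntervalIntegrable w volume (-a) a) :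
    Tendsto (fun t => ∫ s in (-a)..t, w s) (𝓝[<] a) (𝓝 (∫ s in (-a)..a, w s)) := by
  have := continuousOn_integral ha hw a ⟨by linarith, le_rfl⟩
  refine Tendsto.mono_left this ?_
  rw [← nhdsWithin_Ioo_eq_nhdsLT (show -a < a by linarith)]
  exact nhdsWithin_mono _ Ioo_subset_Icc_self

/-- `p x'` is the primitive of the square integrable function `w` which vanishes at both
endpoints. -/
structure HasSource (a : ℝ) (w x : ℝ → ℂ) : Prop where
  memLp : MemLp w 2 (intervalMeasure a)
  integral_eq_zero : ∫ s in (-a)..a, w s = 0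
  hasDerivAt : ∀ t ∈ Ioo (-a) a,
    HasDerivAt x ((∫ s in (-a)..t, w s) / ((1 - t ^ 2 / a ^ 2 : ℝ) : ℂ)) t

lemma absolutelyContinuousOnInterval_flux (hx : x ∈ classA a) {α β : ℝ} (hα : -a < α)
    (hαβ : α ≤ β) (hβ : β < a) : AbsolutelyContinuousOnInterval (flux a x) α β := by
  have hp : ContDiff ℝ 1 (fun t : ℝ => ((1 - t ^ 2 / a ^ 2 : ℝ) : ℂ)) :=
    Complex.ofRealCLM.contDiff.comp (contDiff_const.sub ((contDiff_id.pow 2).div_const _))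
  exact (hp.contDiffOn.absolutelyContinuousOnInterval).fun_smul (hx.2 α β hα hαβ hβ)

lemma memLp_deriv_flux (hx : x ∈ domainMax a) :
    MemLp (deriv (flux a x)) 2 (intervalMeasure a) := by
  have h1 : MemLp (fun t : ℝ => ((t ^ 2 : ℝ) : ℂ) * x t) 2 (intervalMeasure a) := by
    refine MemLp.of_le_mul (c := a ^ 2) hx.2.1 ?_ ?_
    · exact (Measurable.aestronglyMeasurable (by fun_prop)).mul hx.2.1.1
    · filter_upwards [ae_restrict_mem measurableSet_Ioo] with t ht
      rw [norm_mul, Complex.norm_real, Real.norm_of_nonneg (sq_nonneg t)]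
      gcongr ?_ * _
      nlinarith [ht.1, ht.2]
  have := h1.sub hx.2.2
  refine (memLp_congr_ae (ae_of_all _ fun t => ?_)).1 this
  simp [formalL]

/-- `p = (a + t)(a - t) / a²`, and the factor `(a - t) / a²` stays bounded near `-a`. -/
lemma tendsto_flux_left (ha : 0 < a)
    (h : Tendsto (fun t : ℝ => ((t + a : ℝ) : ℂ) * deriv x t) (𝓝[>] (-a)) (𝓝 0)) :
    Tendsto (flux a x) (𝓝[>] (-a)) (𝓝 0) := by
  have hc : Tendsto (fun t : ℝ => (((a - t) / a ^ 2 : ℝ) : ℂ)) (𝓝[>] (-a))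
      (𝓝 (((a - -a) / a ^ 2 : ℝ) : ℂ)) := by
    refine Tendsto.mono_left (Continuous.tendsto ?_ (-a)) nhdsWithin_le_nhds
    fun_prop
  have := hc.mul h
  rw [mul_zero] at this
  refine this.congr fun t => ?_
  rw [flux, ← mul_assoc, ← Complex.ofReal_mul]
  congr 2
  field_simp
  ring

lemma tendsto_flux_right (ha : 0 < a)
    (h : Tendsto (fun t : ℝ => ((t - a : ℝ) : ℂ) * deriv x t) (𝓝[<] a) (𝓝 0)) :
    Tendsto (flux a x) (𝓝[<] a) (𝓝 0) := by
  have hc : Tendsto (fun t : ℝ => ((-(a + t) / a ^ 2 : ℝ) : ℂ)) (𝓝[<] a)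
      (𝓝 ((-(a + a) / a ^ 2 : ℝ) : ℂ)) := by
    refine Tendsto.mono_left (Continuous.tendsto ?_ a) nhdsWithin_le_nhds
    fun_prop
  have := hc.mul h
  rw [mul_zero] at this
  refine this.congr fun t => ?_
  rw [flux, ← mul_assoc, ← Complex.ofReal_mul]
  congr 2
  field_simp
  ring

/-- The two sides differ by a constant on the interval, and both tend to zero at `-a`, the flux by
the boundary condition. -/
lemma flux_eq_integral (ha : 0 < a) (hx : x ∈ domainI a) {t : ℝ} (ht : t ∈ Ioo (-a) a) :
    flux a x t = ∫ s in (-a)..t, deriv (flux a x) s := by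
  set w := deriv (flux a x) with hw
  have hwi := intervalIntegrable_of_memLp (memLp_deriv_flux hx.1) ha
  have hsub : ∀ ⦃s⦄, s ∈ Ioo (-a) t → flux a x s - ∫ r in (-a)..s, w r =
      flux a x t - ∫ r in (-a)..t, w r := by
    intro s hs
    have hst : uIcc s t ⊆ uIcc (-a) a := by
      rw [uIcc_of_le hs.2.le, uIcc_of_le (by linarith)]
      exact Icc_subset_Icc hs.1.le ht.2.le
    have h1 := integral_eq_sub_of_absolutelyContinuous
      (absolutelyContinuousOnInterval_flux hx.1.1 hs.1 hs.2.le ht.2) (hwi.mono_set hst) (by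
        have := ae_differentiableAt_deriv hx.1.1
        rw [ae_restrict_iff' measurableSet_Ioo] at this
        filter_upwards [this] with r hr hmem
        rw [uIcc_of_le hs.2.le] at hmem
        exact (differentiableAt_flux
          (hr ⟨hs.1.trans_le hmem.1, hmem.2.trans_lt ht.2⟩)).hasDerivAt)
    have h2 := intervalIntegral.integral_add_adjacent_intervals
      (hwi.mono_set (uIcc_subset_uIcc left_mem_uIcc (hst left_mem_uIcc))) (hwi.mono_set hst)
    rw [← hw] at h1 h2
    linear_combination h1 - h2
  have hlim := (tendsto_flux_left ha hx.2.1).sub (tendsto_integral_left ha hwi)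
  rw [sub_zero] at hlim
  have hlim' : Tendsto (fun _ : ℝ => flux a x t - ∫ r in (-a)..t, w r) (𝓝[>] (-a)) (𝓝 0) := by
    refine hlim.congr' ?_
    filter_upwards [Ioo_mem_nhdsGT ht.1] with s hs using hsub hs
  exact sub_eq_zero.1 (tendsto_nhds_unique tendsto_const_nhds hlim')

lemma hasSource_of_mem_domainI (ha : 0 < a) (hx : x ∈ domainI a) :
    HasSource a (deriv (flux a x)) x := by
  have hmem := memLp_deriv_flux hx.1
  have hwi := intervalIntegrable_of_memLp hmem ha
  refine ⟨hmem, ?_, fun t ht => ?_⟩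
  · refine tendsto_nhds_unique (tendsto_integral_right ha hwi) ?_
    refine (tendsto_flux_right ha hx.2.2).congr' ?_
    filter_upwards [Ioo_mem_nhdsLT (show -a < a by linarith)] with t ht
    exact flux_eq_integral ha hx ht
  · rw [← flux_eq_integral ha hx ht, flux, mul_div_cancel_left₀ _ (coe_one_sub_div_ne_zero ht)]
    exact (hx.1.1.1 t ht).hasDerivAt

/-! ### Regularity at the endpoints -/

/-- A continuous primitive of `1 / √(a + t) + 1 / √(a - t)`. -/
noncomputable def gauge (a t : ℝ) : ℝ := 2 * √(a + t) - 2 * √(a - t)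

@[fun_prop]
lemma continuous_gauge (a : ℝ) : Continuous (gauge a) := by
  unfold gauge
  fun_prop

lemma hasDerivAt_gauge {t : ℝ} (ht : t ∈ Ioo (-a) a) :
    HasDerivAt (gauge a) (1 / √(a + t) + 1 / √(a - t)) t := by
  have h1 : 0 < a + t := by linarith [ht.1]
  have h2 : 0 < a - t := by linarith [ht.2]
  have e1 := (((hasDerivAt_id t).const_add a).sqrt h1.ne').const_mul 2
  have e2 := (((hasDerivAt_id t).const_sub a).sqrt h2.ne').const_mul 2
  refine (e1.sub e2).congr_deriv ?_
  simp only [id]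
  ring

/-- Cauchy-Schwarz, in the form of the comparison of `L¹` and `L²` norms on a set of finite measure.
-/
lemma norm_integral_le (hw : MemLp w 2 (intervalMeasure a)) {α β : ℝ} (hα : -a ≤ α) (hαβ : α ≤ β)
    (hβ : β ≤ a) :
    ‖∫ s in α..β, w s‖ ≤ √(β - α) * (eLpNorm w 2 (intervalMeasure a)).toReal := by
  have hle : volume.restrict (Ioo α β) ≤ intervalMeasure a :=
    Measure.restrict_mono (Ioo_subset_Ioo hα hβ) le_rfl
  have hw' : MemLp w 2 (volume.restrict (Ioo α β)) := hw.mono_measure hle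
  have h1 : ‖∫ s in α..β, w s‖ₑ ≤ eLpNorm w 1 (volume.restrict (Ioo α β)) := by
    rw [intervalIntegral.integral_of_le hαβ, integral_Ioc_eq_integral_Ioo,
      eLpNorm_one_eq_lintegral_enorm]
    exact enorm_integral_le_lintegral_enorm _
  have h2 := eLpNorm_le_eLpNorm_mul_rpow_measure_univ (p := 1) (q := 2) (by norm_num) hw'.1
  have h3 : eLpNorm w 2 (volume.restrict (Ioo α β)) ≤ eLpNorm w 2 (intervalMeasure a) :=
    eLpNorm_mono_measure _ hle
  have h4 := h1.trans (h2.trans (mul_le_mul_left h3 _))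
  have hfin : eLpNorm w 2 (intervalMeasure a) ≠ ⊤ := hw.2.ne
  have hnn : 0 ≤ β - α := sub_nonneg.2 hαβ
  rw [Measure.restrict_apply_univ, Real.volume_Ioo] at h4
  have h5 := ENNReal.toReal_mono (ENNReal.mul_ne_top hfin
    (ENNReal.rpow_ne_top_of_nonneg (by norm_num) ENNReal.ofReal_ne_top)) h4
  rw [toReal_enorm, ENNReal.toReal_mul, ← ENNReal.toReal_rpow, ENNReal.toReal_ofReal hnn] at h5
  refine h5.trans_eq ?_
  rw [mul_comm, Real.sqrt_eq_rpow]
  norm_num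

namespace HasSource

/-- As `w` has total integral zero, its primitive can be estimated from either endpoint, by `√(a +
t)` or `√(a - t)` times the norm of `w`. Half of the vanishing of `p` is thereby compensated. -/
lemma norm_deriv_le (ha : 0 < a) (h : HasSource a w x) {t : ℝ} (ht : t ∈ Ioo (-a) a) :
    ‖(∫ s in (-a)..t, w s) / ((1 - t ^ 2 / a ^ 2 : ℝ) : ℂ)‖ ≤
      a * (eLpNorm w 2 (intervalMeasure a)).toReal * (1 / √(a + t) + 1 / √(a - t)) := by
  set N := (eLpNorm w 2 (intervalMeasure a)).toReal with hN
  have hN0 : 0 ≤ N := ENNReal.toReal_nonneg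
  have h1 : 0 < a + t := by linarith [ht.1]
  have h2 : 0 < a - t := by linarith [ht.2]
  have hwi := intervalIntegrable_of_memLp h.memLp ha
  have e1 : ‖∫ s in (-a)..t, w s‖ ≤ √(a + t) * N := by
    have := norm_integral_le h.memLp le_rfl ht.1.le ht.2.le
    rwa [show t - -a = a + t by ring] at this
  have e2 : ‖∫ s in (-a)..t, w s‖ ≤ √(a - t) * N := by
    have htm : t ∈ uIcc (-a) a := by
      rw [uIcc_of_le (by linarith)]
      exact Ioo_subset_Icc_self ht
    have hadd := intervalIntegral.integral_add_adjacent_intervals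
      (hwi.mono_set (uIcc_subset_uIcc left_mem_uIcc htm))
      (hwi.mono_set (uIcc_subset_uIcc htm right_mem_uIcc))
    rw [h.integral_eq_zero] at hadd
    rw [eq_neg_of_add_eq_zero_left hadd, norm_neg]
    exact norm_integral_le h.memLp ht.1.le ht.2.le le_rfl
  have hp : 1 - t ^ 2 / a ^ 2 = (a + t) * (a - t) / a ^ 2 := by
    field_simp
    ring
  rw [norm_div, Complex.norm_real, Real.norm_of_nonneg (one_sub_div_pos ht).le, hp]
  have s1 : 0 < √(a + t) := Real.sqrt_pos.2 h1
  have s2 : 0 < √(a - t) := Real.sqrt_pos.2 h2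
  have q1 : √(a + t) ^ 2 = a + t := Real.sq_sqrt h1.le
  have q2 : √(a - t) ^ 2 = a - t := Real.sq_sqrt h2.le
  rw [div_le_iff₀ (by positivity)]
  -- The sign of `t` selects the nearer endpoint; the other factor of `p` is then at least `1 / a`
  -- after normalization.
  rcases le_total 0 t with h0 | h0
  · calc ‖∫ s in (-a)..t, w s‖ ≤ √(a - t) * N := e2
      _ ≤ (a + t) / a * (√(a - t) * N) := by
        refine le_mul_of_one_le_left (by positivity) ?_
        rw [one_le_div ha]
        linarith
      _ = a * N * (1 / √(a - t)) * ((a + t) * (a - t) / a ^ 2) := by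
        conv_rhs => rw [← q2]
        rw [Real.sqrt_sq s2.le]
        field_simp
      _ ≤ _ := by
        gcongr
        exact le_add_of_nonneg_left (by positivity)
  · calc ‖∫ s in (-a)..t, w s‖ ≤ √(a + t) * N := e1
      _ ≤ (a - t) / a * (√(a + t) * N) := by
        refine le_mul_of_one_le_left (by positivity) ?_
        rw [one_le_div ha]
        linarith
      _ = a * N * (1 / √(a + t)) * ((a + t) * (a - t) / a ^ 2) := by
        conv_rhs => rw [← q1]
        rw [Real.sqrt_sq s1.le]
        field_simp
      _ ≤ _ := by
        gcongr
        exact le_add_of_nonneg_right (by positivity)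

/-- The mean value inequality with a multiple of `gauge` as majorant, whose derivative is the bound
in `norm_deriv_le`. -/
lemma norm_sub_le_of_le (ha : 0 < a) (h : HasSource a w x) {s t : ℝ} (hs : s ∈ Ioo (-a) a)
    (ht : t ∈ Ioo (-a) a) (hst : s ≤ t) :
    ‖x t - x s‖ ≤ a * (eLpNorm w 2 (intervalMeasure a)).toReal * (gauge a t - gauge a s) := by
  have hsub : Icc s t ⊆ Ioo (-a) a := fun r hr => ⟨hs.1.trans_le hr.1, hr.2.trans_lt ht.2⟩
  refine image_norm_le_of_norm_deriv_right_le_deriv_boundary'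
    (f := fun r => x r - x s)
    (B := fun r => a * (eLpNorm w 2 (intervalMeasure a)).toReal * (gauge a r - gauge a s))
    (a := s) (b := t) ?_
    (fun r hr => ((h.hasDerivAt r (hsub (Ico_subset_Icc_self hr))).sub_const _).hasDerivWithinAt)
    (by simp) (by fun_prop)
    (fun r hr => (((hasDerivAt_gauge
      (hsub (Ico_subset_Icc_self hr))).sub_const _).const_mul _).hasDerivWithinAt)
    (fun r hr => h.norm_deriv_le ha (hsub (Ico_subset_Icc_self hr))) ⟨hst, le_rfl⟩
  exact fun r hr => ((h.hasDerivAt r (hsub hr)).continuousAt.sub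
    continuousAt_const).continuousWithinAt

lemma dist_le (ha : 0 < a) (h : HasSource a w x) {s t : ℝ} (hs : s ∈ Ioo (-a) a)
    (ht : t ∈ Ioo (-a) a) :
    dist (x s) (x t) ≤
      a * (eLpNorm w 2 (intervalMeasure a)).toReal * dist (gauge a s) (gauge a t) := by
  have hN : 0 ≤ a * (eLpNorm w 2 (intervalMeasure a)).toReal := by positivity
  rcases le_total s t with hst | hst
  · rw [dist_comm, dist_comm (gauge a s), dist_eq_norm]
    exact (h.norm_sub_le_of_le ha hs ht hst).trans
      (mul_le_mul_of_nonneg_left (le_abs_self _) hN)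
  · rw [dist_eq_norm]
    exact (h.norm_sub_le_of_le ha ht hs hst).trans
      (mul_le_mul_of_nonneg_left (le_abs_self _) hN)

end HasSource

open scoped NNReal in
/-- A function which is Lipschitz with respect to `Φ` factors through a globally Lipschitz
function of `Φ`. -/
lemma exists_lipschitzWith_comp_eq {f : ℝ → ℂ} {Φ : ℝ → ℝ} {S : Set ℝ} {K : ℝ≥0}
    (h : ∀ s ∈ S, ∀ t ∈ S, dist (f s) (f t) ≤ K * dist (Φ s) (Φ t)) :
    ∃ F : ℝ → ℂ, LipschitzWith (lipschitzExtensionConstant ℂ * K) F ∧ ∀ s ∈ S, F (Φ s) = f s := by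
  have hmem : ∀ u ∈ Φ '' S, Function.invFunOn Φ S u ∈ S := fun u hu =>
    Function.invFunOn_mem hu
  have heq : ∀ u ∈ Φ '' S, Φ (Function.invFunOn Φ S u) = u := fun u hu =>
    Function.invFunOn_eq hu
  have hL : LipschitzOnWith K (fun u => f (Function.invFunOn Φ S u)) (Φ '' S) := by
    refine LipschitzOnWith.of_dist_le_mul fun u hu v hv => ?_
    have := h _ (hmem u hu) _ (hmem v hv)
    rwa [heq u hu, heq v hv] at this
  obtain ⟨F, hF, hE⟩ := hL.extend_finite_dimension
  refine ⟨F, hF, fun s hs => ?_⟩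
  have hu := mem_image_of_mem Φ hs
  rw [← hE hu]
  have := h _ (hmem _ hu) s hs
  rw [heq _ hu, dist_self, mul_zero] at this
  exact dist_le_zero.1 this

namespace HasSource

/-- Besides giving a continuous extension, the Lipschitz constant depends on `w` only through its
norm; this provides the equicontinuity for compactness. -/
lemma exists_factor (ha : 0 < a) (h : HasSource a w x) :
    ∃ F : ℝ → ℂ, LipschitzWith (lipschitzExtensionConstant ℂ *
      (a * (eLpNorm w 2 (intervalMeasure a)).toReal).toNNReal) F ∧
      ∀ s ∈ Ioo (-a) a, F (gauge a s) = x s := by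
  refine exists_lipschitzWith_comp_eq fun s hs t ht => ?_
  rw [Real.coe_toNNReal _ (by positivity)]
  exact h.dist_le ha hs ht

lemma exists_continuous_extension (ha : 0 < a) (h : HasSource a w x) :
    ∃ y : ℝ → ℂ, Continuous y ∧ EqOn y x (Ioo (-a) a) := by
  obtain ⟨F, hF, hE⟩ := h.exists_factor ha
  exact ⟨F ∘ gauge a, hF.continuous.comp (continuous_gauge a), hE⟩

end HasSource

lemma memLp_of_continuous_extension {y : ℝ → ℂ} (hy : Continuous y) (h : EqOn y x (Ioo (-a) a)) :
    MemLp x 2 (intervalMeasure a) := by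
  obtain ⟨C, hC⟩ := (isCompact_Icc (a := -a) (b := a)).exists_bound_of_continuousOn
    hy.continuousOn
  have hyx : y =ᵐ[intervalMeasure a] x := by
    filter_upwards [ae_restrict_mem measurableSet_Ioo] with t ht using h ht
  refine (memLp_congr_ae hyx).1 (MemLp.of_bound hy.aestronglyMeasurable C ?_)
  filter_upwards [ae_restrict_mem measurableSet_Ioo] with t ht using hC t (Ioo_subset_Icc_self ht)

namespace HasSource

lemma flux_eq (h : HasSource a w x) {t : ℝ} (ht : t ∈ Ioo (-a) a) :
    flux a x t = ∫ s in (-a)..t, w s := by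
  rw [flux, (h.hasDerivAt t ht).deriv, mul_div_cancel₀ _ (coe_one_sub_div_ne_zero ht)]

lemma formalL_ae_eq (ha : 0 < a) (h : HasSource a w x) :
    formalL a x =ᵐ[intervalMeasure a] fun t => -w t + ((t ^ 2 : ℝ) : ℂ) * x t := by
  have := (intervalIntegrable_of_memLp h.memLp ha).ae_hasDerivAt_integral
  rw [EventuallyEq, ae_restrict_iff' measurableSet_Ioo]
  filter_upwards [this] with t hd ht
  have hI := hd (by rw [uIcc_of_le (by linarith)]; exact Ioo_subset_Icc_self ht) (-a) left_mem_uIcc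
  have he : flux a x =ᶠ[𝓝 t] fun t => ∫ s in (-a)..t, w s := by
    filter_upwards [isOpen_Ioo.mem_nhds ht] with s hs using h.flux_eq hs
  rw [formalL, he.deriv_eq, hI.deriv]

/-- Converse of `hasSource_of_mem_domainI`. Square integrability of `x` comes from its continuous
extension, and the boundary conditions from the vanishing of the primitive of `w` at both ends. -/
lemma mem_domainI (ha : 0 < a) (h : HasSource a w x) : x ∈ domainI a := by
  have hwi := intervalIntegrable_of_memLp h.memLp ha
  obtain ⟨y, hy, hyx⟩ := h.exists_continuous_extension ha
  have hx2 : MemLp x 2 (intervalMeasure a) := memLp_of_continuous_extension hy hyx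
  refine ⟨⟨⟨fun t ht => (h.hasDerivAt t ht).differentiableAt, fun α β h1 h2 h3 => ?_⟩, hx2, ?_⟩,
    ?_, ?_⟩
  · have hsub : uIcc α β ⊆ Ioo (-a) a := by
      rw [uIcc_of_le h2]
      exact fun t ht => ⟨h1.trans_le ht.1, ht.2.trans_lt h3⟩
    have hU : AbsolutelyContinuousOnInterval (fun t => ∫ s in (-a)..t, w s) α β := by
      refine (absolutelyContinuousOnInterval_integral hwi left_mem_uIcc).mono ?_
      refine hsub.trans ?_
      rw [uIcc_of_le (by linarith)]
      exact Ioo_subset_Icc_self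
    have hp : ContDiffOn ℝ 1 (fun t : ℝ => (((1 - t ^ 2 / a ^ 2)⁻¹ : ℝ) : ℂ)) (uIcc α β) := by
      refine Complex.ofRealCLM.contDiff.comp_contDiffOn ?_
      exact ContDiffOn.inv (by fun_prop) fun t ht => (one_sub_div_pos (hsub ht)).ne'
    refine absolutelyContinuousOnInterval_congr
      (hp.absolutelyContinuousOnInterval.fun_smul hU) fun t ht => ?_
    rw [(h.hasDerivAt t (hsub ht)).deriv, smul_eq_mul, Complex.ofReal_inv, inv_mul_eq_div]
  · refine (memLp_congr_ae (h.formalL_ae_eq ha)).2 ?_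
    refine MemLp.add h.memLp.neg ?_
    refine memLp_of_continuous_extension (y := fun t : ℝ => ((t ^ 2 : ℝ) : ℂ) * y t)
      (by fun_prop) fun t ht => ?_
    simp only [hyx ht]
  · have hc : Tendsto (fun t : ℝ => ((a ^ 2 / (a - t) : ℝ) : ℂ)) (𝓝[>] (-a))
        (𝓝 ((a ^ 2 / (a - -a) : ℝ) : ℂ)) := by
      refine Tendsto.mono_left (ContinuousAt.tendsto ?_) nhdsWithin_le_nhds
      refine Complex.continuous_ofReal.continuousAt.comp ?_
      exact ContinuousAt.div (by fun_prop) (by fun_prop) (by linarith)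
    have := hc.mul (tendsto_integral_left ha hwi)
    rw [mul_zero] at this
    refine this.congr' ?_
    filter_upwards [Ioo_mem_nhdsGT (show -a < a by linarith)] with t ht
    rw [(h.hasDerivAt t ht).deriv, mul_div_assoc', mul_div_right_comm, ← Complex.ofReal_div]
    congr 2
    have h1 : a + t ≠ 0 := by linarith [ht.1]
    have h2 : a - t ≠ 0 := by linarith [ht.2]
    rw [show 1 - t ^ 2 / a ^ 2 = (a + t) * (a - t) / a ^ 2 by field_simp; ring]
    field_simp
    ring
  · have hc : Tendsto (fun t : ℝ => ((-a ^ 2 / (a + t) : ℝ) : ℂ)) (𝓝[<] a)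
        (𝓝 ((-a ^ 2 / (a + a) : ℝ) : ℂ)) := by
      refine Tendsto.mono_left (ContinuousAt.tendsto ?_) nhdsWithin_le_nhds
      refine Complex.continuous_ofReal.continuousAt.comp ?_
      exact ContinuousAt.div (by fun_prop) (by fun_prop) (by linarith)
    have := hc.mul (tendsto_integral_right ha hwi)
    rw [h.integral_eq_zero, mul_zero] at this
    refine this.congr' ?_
    filter_upwards [Ioo_mem_nhdsLT (show -a < a by linarith)] with t ht
    rw [(h.hasDerivAt t ht).deriv, mul_div_assoc', mul_div_right_comm, ← Complex.ofReal_div]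
    congr 2
    have h1 : a + t ≠ 0 := by linarith [ht.1]
    have h2 : a - t ≠ 0 := by linarith [ht.2]
    rw [show 1 - t ^ 2 / a ^ 2 = (a + t) * (a - t) / a ^ 2 by field_simp; ring]
    field_simp
    ring

end HasSource

/-! ### Linearity of sources and integration by parts -/

namespace HasSource

lemma congr (h : HasSource a w x) (hxy : EqOn y x (Ioo (-a) a)) : HasSource a w y := by
  refine ⟨h.memLp, h.integral_eq_zero, fun t ht => (h.hasDerivAt t ht).congr_of_eventuallyEq ?_⟩
  filter_upwards [isOpen_Ioo.mem_nhds ht] with s hs using hxy hs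

lemma congr_source (ha : 0 < a) (h : HasSource a w x) (hwv : w =ᵐ[intervalMeasure a] v) :
    HasSource a v x := by
  have hI : ∀ t ∈ Ioc (-a) a, ∫ s in (-a)..t, w s = ∫ s in (-a)..t, v s := by
    intro t ht
    rw [intervalIntegral.integral_of_le ht.1.le, intervalIntegral.integral_of_le ht.1.le,
      integral_Ioc_eq_integral_Ioo, integral_Ioc_eq_integral_Ioo]
    exact integral_congr_ae (ae_restrict_of_ae_restrict_of_subset
      (Ioo_subset_Ioo_right ht.2) hwv)
  refine ⟨(memLp_congr_ae hwv).1 h.memLp, ?_, fun t ht => ?_⟩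
  · rw [← hI a ⟨by linarith, le_rfl⟩, h.integral_eq_zero]
  · rw [← hI t ⟨ht.1, ht.2.le⟩]
    exact h.hasDerivAt t ht

lemma add (ha : 0 < a) (h : HasSource a w x) (h' : HasSource a v y) :
    HasSource a (w + v) (x + y) := by
  have h1 := intervalIntegrable_of_memLp h.memLp ha
  have h2 := intervalIntegrable_of_memLp h'.memLp ha
  have hI : ∀ t ∈ Icc (-a) a, ∫ s in (-a)..t, (w + v) s =
      (∫ s in (-a)..t, w s) + ∫ s in (-a)..t, v s := by
    intro t ht
    have hsub : uIcc (-a) t ⊆ uIcc (-a) a := by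
      rw [uIcc_of_le ht.1, uIcc_of_le (by linarith)]
      exact Icc_subset_Icc_right ht.2
    exact intervalIntegral.integral_add (h1.mono_set hsub) (h2.mono_set hsub)
  refine ⟨h.memLp.add h'.memLp, ?_, fun t ht => ?_⟩
  · rw [hI a ⟨by linarith, le_rfl⟩, h.integral_eq_zero, h'.integral_eq_zero, add_zero]
  · rw [hI t (Ioo_subset_Icc_self ht), add_div]
    exact (h.hasDerivAt t ht).add (h'.hasDerivAt t ht)

lemma smul (c : ℂ) (h : HasSource a w x) : HasSource a (c • w) (c • x) := by
  have hI : ∀ t, ∫ s in (-a)..t, (c • w) s = c * ∫ s in (-a)..t, w s := fun t =>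
    intervalIntegral.integral_smul c w
  refine ⟨h.memLp.const_smul c, by rw [hI, h.integral_eq_zero, mul_zero], fun t ht => ?_⟩
  rw [hI, mul_div_assoc]
  exact (h.hasDerivAt t ht).const_smul c

lemma add_const (h : HasSource a w x) (c : ℂ) : HasSource a w (fun t => x t + c) :=
  ⟨h.memLp, h.integral_eq_zero, fun t ht => (h.hasDerivAt t ht).add_const c⟩

/-- The source and the value at the origin determine the function. -/
lemma eqOn (ha : 0 < a) (h : HasSource a w x) (h' : HasSource a v y)
    (hwv : w =ᵐ[intervalMeasure a] v) (h0 : x 0 = y 0) : EqOn x y (Ioo (-a) a) := by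
  have hd := h.add ha (h'.smul (-1))
  have hz : w + (-1 : ℂ) • v =ᵐ[intervalMeasure a] 0 := by
    filter_upwards [hwv] with t ht
    simp [ht]
  intro t ht
  have hm : (0 : ℝ) ∈ Ioo (-a) a := ⟨by linarith, ha⟩
  have := hd.dist_le ha ht hm
  rw [eLpNorm_congr_ae hz, eLpNorm_zero] at this
  simp only [ENNReal.toReal_zero, mul_zero, zero_mul] at this
  have := dist_le_zero.1 this
  simp only [Pi.add_apply, Pi.smul_apply, smul_eq_mul, h0] at this
  linear_combination this

lemma continuousOn_deriv (ha : 0 < a) (h : HasSource a w x) :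
    ContinuousOn (fun t => (∫ s in (-a)..t, w s) / ((1 - t ^ 2 / a ^ 2 : ℝ) : ℂ))
      (Ioo (-a) a) := by
  refine ContinuousOn.div ?_ (by fun_prop) fun t ht => coe_one_sub_div_ne_zero ht
  exact (continuousOn_integral ha (intervalIntegrable_of_memLp h.memLp ha)).mono
    Ioo_subset_Icc_self

lemma absolutelyContinuousOnInterval (ha : 0 < a) (h : HasSource a w x) {α β : ℝ}
    (hsub : uIcc α β ⊆ Ioo (-a) a) : AbsolutelyContinuousOnInterval x α β := by
  obtain ⟨C, hC⟩ := isCompact_uIcc.exists_bound_of_continuousOn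
    ((h.continuousOn_deriv ha).mono hsub)
  refine LipschitzOnWith.absolutelyContinuousOnInterval (K := C.toNNReal)
    ((convex_uIcc α β).lipschitzOnWith_of_nnnorm_hasDerivWithin_le
      (fun t ht => (h.hasDerivAt t (hsub ht)).hasDerivWithinAt) fun t ht => ?_)
  rw [← NNReal.coe_le_coe, coe_nnnorm]
  exact (hC t ht).trans (Real.le_coe_toNNReal C)

open ComplexConjugate in
-- Integrate by parts on `[-b, b]` and let `b → a`: the boundary terms vanish because `p x'` does
-- and `x` is continuous, leaving minus the Dirichlet energy. Only its sign on each `[-b, b]` is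
-- used, so its convergence need not be discussed.
lemma integral_mul_conj_of_continuous (ha : 0 < a) (h : HasSource a w x) (hx : Continuous x) :
    (∫ t in (-a)..a, w t * conj (x t)).im = 0 ∧ (∫ t in (-a)..a, w t * conj (x t)).re ≤ 0 := by
  have hwi := intervalIntegrable_of_memLp h.memLp ha
  have hcx : Continuous fun t => conj (x t) := Complex.continuous_conj.comp hx
  have hwx : IntervalIntegrable (fun t => w t * conj (x t)) volume (-a) a :=
    hwi.mul_continuousOn hcx.continuousOn
  set U : ℝ → ℂ := fun t => ∫ s in (-a)..t, w s with hU
  set J : ℝ → ℂ := fun t => ∫ s in (-a)..t, w s * conj (x s) with hJ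
  have hneg : Tendsto (fun b : ℝ => -b) (𝓝[<] a) (𝓝[>] (-a)) := tendsto_neg_nhdsLT
  have hJlim : Tendsto (fun b => J b - J (-b)) (𝓝[<] a) (𝓝 (J a)) := by
    have := (tendsto_integral_right ha hwx).sub ((tendsto_integral_left ha hwx).comp hneg)
    rwa [sub_zero] at this
  have hFlim : Tendsto (fun b => U b * conj (x b) - U (-b) * conj (x (-b))) (𝓝[<] a) (𝓝 0) := by
    have h1 := (tendsto_integral_right ha hwi).mul
      ((hcx.tendsto a).mono_left (nhdsWithin_le_nhds (s := Iio a)))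
    have h2 := ((tendsto_integral_left ha hwi).mul
      ((hcx.tendsto (-a)).mono_left (nhdsWithin_le_nhds (s := Ioi (-a))))).comp hneg
    have := h1.sub h2
    rwa [h.integral_eq_zero, zero_mul, zero_mul, sub_zero] at this
  -- The witness `q` is `∫ p|x'|²` over `[-b, b]`, written as `∫ |U|² / p`.
  have key : ∀ b ∈ Ioo 0 a, ∃ q : ℝ, 0 ≤ q ∧
      J b - J (-b) + q = U b * conj (x b) - U (-b) * conj (x (-b)) := by
    intro b hb
    have hle : -b ≤ b := by linarith [hb.1]
    have hsub : uIcc (-b) b ⊆ Ioo (-a) a := by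
      rw [uIcc_of_le hle]
      exact fun t ht => ⟨by linarith [ht.1, hb.2], by linarith [ht.2, hb.2]⟩
    have hsub' : uIcc (-b) b ⊆ uIcc (-a) a := by
      refine hsub.trans ?_
      rw [uIcc_of_le (by linarith)]
      exact Ioo_subset_Icc_self
    have hUac : AbsolutelyContinuousOnInterval U (-b) b :=
      (absolutelyContinuousOnInterval_integral hwi left_mem_uIcc).mono hsub'
    have hxac : AbsolutelyContinuousOnInterval (fun t => conj (x t)) (-b) b := by
      have := h.absolutelyContinuousOnInterval ha hsub
      rw [absolutelyContinuousOnInterval_iff] at this ⊢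
      simpa only [Complex.dist_conj_conj] using this
    have hq : ContinuousOn (fun t => U t * conj (U t / ((1 - t ^ 2 / a ^ 2 : ℝ) : ℂ)))
        (uIcc (-b) b) := by
      refine ContinuousOn.mul hUac.continuousOn ?_
      exact Complex.continuous_conj.comp_continuousOn ((h.continuousOn_deriv ha).mono hsub)
    have hFTC := integral_eq_sub_of_absolutelyContinuous (hUac.fun_smul hxac)
      (f' := fun t => w t * conj (x t) + U t * conj (U t / ((1 - t ^ 2 / a ^ 2 : ℝ) : ℂ)))
      ((hwx.mono_set hsub').add hq.intervalIntegrable) (by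
        filter_upwards [hwi.ae_hasDerivAt_integral] with t h1 ht
        have e1 := h1 (hsub' ht) (-a) left_mem_uIcc
        have e2 := Complex.conjCLE.toContinuousLinearMap.hasFDerivAt.comp_hasDerivAt t
          (h.hasDerivAt t (hsub ht))
        exact e1.mul e2)
    rw [intervalIntegral.integral_add (hwx.mono_set hsub') hq.intervalIntegrable] at hFTC
    refine ⟨∫ t in (-b)..b, ‖U t‖ ^ 2 / (1 - t ^ 2 / a ^ 2), ?_, ?_⟩
    · refine intervalIntegral.integral_nonneg hle fun t ht => ?_
      have := one_sub_div_pos (hsub (by rwa [uIcc_of_le hle]))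
      positivity
    · have hJb : J b - J (-b) = ∫ t in (-b)..b, w t * conj (x t) :=
        intervalIntegral.integral_interval_sub_left
          (hwx.mono_set (uIcc_subset_uIcc left_mem_uIcc (hsub' right_mem_uIcc)))
          (hwx.mono_set (uIcc_subset_uIcc left_mem_uIcc (hsub' left_mem_uIcc)))
      rw [hJb, ← intervalIntegral.integral_ofReal]
      simp only [smul_eq_mul] at hFTC
      rw [← hFTC]
      congr 1
      refine intervalIntegral.integral_congr fun t _ => ?_
      simp only [map_div₀, Complex.conj_ofReal, mul_div_assoc']
      rw [Complex.mul_conj, Complex.normSq_eq_norm_sq]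
      push_cast
      rfl
  have hev : ∀ᶠ b in 𝓝[<] a, b ∈ Ioo 0 a := Ioo_mem_nhdsLT ha
  constructor
  · refine tendsto_nhds_unique ((Complex.continuous_im.tendsto _).comp hJlim) ?_
    have := (Complex.continuous_im.tendsto _).comp hFlim
    rw [Complex.zero_im] at this
    refine this.congr' ?_
    filter_upwards [hev] with b hb
    obtain ⟨q, -, hq⟩ := key b hb
    simp only [Function.comp, ← hq, Complex.add_im, Complex.ofReal_im, add_zero]
  · refine le_of_tendsto_of_tendsto ((Complex.continuous_re.tendsto _).comp hJlim)
      ((Complex.continuous_re.tendsto _).comp hFlim) ?_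
    filter_upwards [hev] with b hb
    obtain ⟨q, hq0, hq⟩ := key b hb
    simp only [Function.comp, ← hq, Complex.add_re, Complex.ofReal_re]
    linarith

open ComplexConjugate in
lemma integral_mul_conj (ha : 0 < a) (h : HasSource a w x) :
    (∫ t, w t * conj (x t) ∂(intervalMeasure a)).im = 0 ∧
      (∫ t, w t * conj (x t) ∂(intervalMeasure a)).re ≤ 0 := by
  obtain ⟨y, hy, hyx⟩ := h.exists_continuous_extension ha
  have := (h.congr hyx).integral_mul_conj_of_continuous ha hy
  rw [intervalIntegral.integral_of_le (by linarith), integral_Ioc_eq_integral_Ioo,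
    setIntegral_congr_fun measurableSet_Ioo (g := fun t => w t * conj (x t))
      (fun t ht => by simp only [hyx ht])] at this
  exact this

end HasSource

/-! ### The quadratic form of the operator -/

/-- With its converse `HasSource.operatorI_apply`, this translates statements about the operator
into statements about sources. -/
lemma exists_source (ha : 0 < a) (f : (operatorI a ha).domain) :
    ∃ w x, HasSource a w x ∧ ((f : HilbertL2 a) : ℝ → ℂ) =ᵐ[intervalMeasure a] x ∧
      (operatorI a ha f : ℝ → ℂ) =ᵐ[intervalMeasure a]
        fun t => -w t + ((t ^ 2 : ℝ) : ℂ) * x t := by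
  have hf : ((f : HilbertL2 a), operatorI a ha f) ∈ (operatorI a ha).graph :=
    LinearPMap.mem_graph _ f
  rw [operatorI_graph] at hf
  obtain ⟨x, hx, h1, h2⟩ := hf
  have hs := hasSource_of_mem_domainI ha hx
  exact ⟨_, x, hs, h1, h2.trans (hs.formalL_ae_eq ha)⟩

lemma HasSource.operatorI_apply (ha : 0 < a) (h : HasSource a w x) {f g : HilbertL2 a}
    (hf : (f : ℝ → ℂ) =ᵐ[intervalMeasure a] x)
    (hg : (g : ℝ → ℂ) =ᵐ[intervalMeasure a] fun t => -w t + ((t ^ 2 : ℝ) : ℂ) * x t) :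
    ∃ hd : f ∈ (operatorI a ha).domain, operatorI a ha ⟨f, hd⟩ = g := by
  have : (f, g) ∈ (operatorI a ha).graph := by
    rw [operatorI_graph]
    exact ⟨x, h.mem_domainI ha, hf, hg.trans (h.formalL_ae_eq ha).symm⟩
  obtain ⟨y, hy1, hy2⟩ := (LinearPMap.mem_graph_iff _).1 this
  simp only at hy1 hy2
  subst hy1
  exact ⟨y.2, hy2⟩

open ComplexConjugate in
-- The Dirichlet part is only nonnegative, as constants show; strictness comes from `∫ t²|x|²`,
-- whose weight vanishes only at the null set `{0}`.
lemma form_pos (ha : 0 < a) (f : (operatorI a ha).domain) (h0 : (f : HilbertL2 a) ≠ 0) :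
    ∃ r : ℝ, 0 < r ∧ inner ℂ (f : HilbertL2 a) (operatorI a ha f) = r := by
  obtain ⟨w, x, h, hf, hA⟩ := exists_source ha f
  obtain ⟨y, hy, hyx⟩ := h.exists_continuous_extension ha
  have hcx : MemLp (fun t => conj (x t)) 2 (intervalMeasure a) :=
    memLp_of_continuous_extension (y := fun t => conj (y t)) (Complex.continuous_conj.comp hy)
      fun t ht => by simp only [hyx ht]
  have h1 : Integrable (fun t => w t * conj (x t)) (intervalMeasure a) :=
    h.memLp.integrable_mul hcx
  have h2 : Integrable (fun t : ℝ => t ^ 2 * ‖x t‖ ^ 2) (intervalMeasure a) := by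
    have hc : Continuous fun t : ℝ => t ^ 2 * ‖y t‖ ^ 2 := by fun_prop
    have := (hc.continuousOn (s := Icc (-a) a)).integrableOn_compact
      (μ := volume) isCompact_Icc
    refine (integrable_congr ?_).1 (this.mono_set (Ioo_subset_Icc_self (a := -a) (b := a)))
    filter_upwards [ae_restrict_mem measurableSet_Ioo] with t ht
    simp only [hyx ht]
  have hinner : inner ℂ (f : HilbertL2 a) (operatorI a ha f) =
      -(∫ t, w t * conj (x t) ∂(intervalMeasure a)) +
        ((∫ t : ℝ, t ^ 2 * ‖x t‖ ^ 2 ∂(intervalMeasure a) : ℝ) : ℂ) := by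
    rw [L2.inner_def, ← integral_complex_ofReal, ← integral_neg]
    refine Eq.trans ?_ (integral_add h1.neg h2.ofReal)
    refine integral_congr_ae ?_
    filter_upwards [hf, hA] with t e1 e2
    rw [e1, e2]
    simp only [RCLike.inner_apply]
    have : (‖x t‖ : ℂ) ^ 2 = x t * conj (x t) := by
      rw [Complex.mul_conj, Complex.normSq_eq_norm_sq]
      push_cast
      rfl
    push_cast
    rw [this]
    ring
  have hpos : 0 < ∫ t : ℝ, t ^ 2 * ‖x t‖ ^ 2 ∂(intervalMeasure a) := by
    refine lt_of_le_of_ne (integral_nonneg fun t => by positivity) fun hz => h0 ?_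
    rw [eq_comm, integral_eq_zero_iff_of_nonneg (fun t => by positivity) h2] at hz
    refine Lp.ext ?_
    have hne : ∀ᵐ t ∂(intervalMeasure a), t ≠ 0 := by
      refine ae_restrict_of_ae ?_
      exact Measure.ae_ne volume 0
    filter_upwards [hf, hz, hne, Lp.coeFn_zero ℂ 2 (intervalMeasure a)] with t e1 e2 e3 e4
    rw [e1, e4]
    simpa [e3] using e2
  obtain ⟨hi, hr⟩ := h.integral_mul_conj ha
  refine ⟨-(∫ t, w t * conj (x t) ∂(intervalMeasure a)).re +
    ∫ t : ℝ, t ^ 2 * ‖x t‖ ^ 2 ∂(intervalMeasure a), by linarith, ?_⟩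
  rw [hinner]
  apply Complex.ext <;> simp [hi]

/-! ### The compact inverse -/

/-- The solution of `(p x')' = w` with `x 0 = 0` and `p x' → 0` at `-a`. -/
noncomputable def solve (a : ℝ) (w : ℝ → ℂ) (t : ℝ) : ℂ :=
  ∫ s in (0 : ℝ)..t, (∫ r in (-a)..s, w r) / ((1 - s ^ 2 / a ^ 2 : ℝ) : ℂ)

lemma solve_zero (a : ℝ) (w : ℝ → ℂ) : solve a w 0 = 0 := intervalIntegral.integral_same

lemma hasSource_solve (ha : 0 < a) (hw : MemLp w 2 (intervalMeasure a))
    (h0 : ∫ s in (-a)..a, w s = 0) : HasSource a w (solve a w) := by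
  refine ⟨hw, h0, fun t ht => ?_⟩
  have hc : ContinuousOn (fun s => (∫ r in (-a)..s, w r) / ((1 - s ^ 2 / a ^ 2 : ℝ) : ℂ))
      (Ioo (-a) a) := by
    refine ContinuousOn.div ?_ (by fun_prop) fun t ht => coe_one_sub_div_ne_zero ht
    exact (continuousOn_integral ha (intervalIntegrable_of_memLp hw ha)).mono
      Ioo_subset_Icc_self
  have hsub : uIcc 0 t ⊆ Ioo (-a) a :=
    (convex_Ioo (-a) a).ordConnected.uIcc_subset ⟨by linarith, ha⟩ ht
  exact intervalIntegral.integral_hasDerivAt_right (hc.mono hsub).intervalIntegrable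
    (hc.stronglyMeasurableAtFilter isOpen_Ioo t ht) (hc.continuousAt (isOpen_Ioo.mem_nhds ht))

/-- The constant function one. -/
noncomputable def constOne (a : ℝ) : HilbertL2 a := (memLp_const (1 : ℂ)).toLp (fun _ => (1 : ℂ))

lemma coeFn_constOne (a : ℝ) : (constOne a : ℝ → ℂ) =ᵐ[intervalMeasure a] fun _ => 1 :=
  MemLp.coeFn_toLp _

lemma inner_constOne (ha : 0 < a) (f : HilbertL2 a) :
    inner ℂ (constOne a) f = ∫ s in (-a)..a, f s := by
  rw [L2.inner_def, intervalIntegral.integral_of_le (by linarith), integral_Ioc_eq_integral_Ioo]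
  refine integral_congr_ae ?_
  filter_upwards [coeFn_constOne a] with t ht
  simp [ht]

/-- The projection onto the constants. -/
noncomputable def meanProj (a : ℝ) : HilbertL2 a →L[ℂ] HilbertL2 a :=
  ((2 * a : ℝ) : ℂ)⁻¹ • (innerSL ℂ (constOne a)).smulRight (constOne a)

lemma meanProj_apply (f : HilbertL2 a) :
    meanProj a f = (((2 * a : ℝ) : ℂ)⁻¹ * inner ℂ (constOne a) f) • constOne a := by
  simp [meanProj, smul_smul]

lemma inner_constOne_self (ha : 0 < a) :
    inner ℂ (constOne a) (constOne a) = ((2 * a : ℝ) : ℂ) := by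
  rw [inner_constOne ha, intervalIntegral.integral_of_le (by linarith),
    integral_Ioc_eq_integral_Ioo, integral_congr_ae (coeFn_constOne a), integral_const]
  rw [measureReal_restrict_apply_univ, Real.volume_real_Ioo_of_le (by linarith)]
  simp
  ring

lemma inner_constOne_meanProj (ha : 0 < a) (f : HilbertL2 a) :
    inner ℂ (constOne a) (meanProj a f) = inner ℂ (constOne a) f := by
  have hne : ((2 * a : ℝ) : ℂ) ≠ 0 := Complex.ofReal_ne_zero.2 (by positivity)
  rw [meanProj_apply, inner_smul_right, inner_constOne_self ha]
  field_simp

lemma meanProj_meanProj (ha : 0 < a) (f : HilbertL2 a) :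
    meanProj a (meanProj a f) = meanProj a f := by
  rw [meanProj_apply (meanProj a f), inner_constOne_meanProj ha, ← meanProj_apply]

lemma isCompactOperator_meanProj (a : ℝ) : IsCompactOperator (meanProj a) := by
  have h1 : IsCompactOperator (innerSL ℂ (constOne a)) :=
    isCompactOperator_of_locallyCompactSpace_dom (innerSL ℂ (constOne a))
  have h2 := h1.clm_comp ((1 : ℂ →L[ℂ] ℂ).smulRight (constOne a))
  have h3 := h2.smul (((2 * a : ℝ) : ℂ)⁻¹)
  have he : (meanProj a : HilbertL2 a → HilbertL2 a) = ((2 * a : ℝ) : ℂ)⁻¹ •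
      (((1 : ℂ →L[ℂ] ℂ).smulRight (constOne a)) ∘ (innerSL ℂ (constOne a))) := by
    funext f
    simp [meanProj]
  rw [he]
  exact h3

lemma meanProj_ae_eq (f : HilbertL2 a) :
    ∃ c : ℂ, (meanProj a f : ℝ → ℂ) =ᵐ[intervalMeasure a] fun _ => c := by
  refine ⟨((2 * a : ℝ) : ℂ)⁻¹ * inner ℂ (constOne a) f, ?_⟩
  rw [meanProj_apply]
  filter_upwards [Lp.coeFn_smul (((2 * a : ℝ) : ℂ)⁻¹ * inner ℂ (constOne a) f) (constOne a),
    coeFn_constOne a] with t h1 h2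
  rw [h1]
  simp [h2]

/-- The source `mean f - f`. -/
noncomputable def meanDefect (a : ℝ) : HilbertL2 a →L[ℂ] HilbertL2 a :=
  meanProj a - ContinuousLinearMap.id ℂ _

lemma integral_meanDefect (ha : 0 < a) (f : HilbertL2 a) :
    ∫ s in (-a)..a, meanDefect a f s = 0 := by
  rw [← inner_constOne ha]
  simp [meanDefect, inner_sub_right, inner_constOne_meanProj ha]

lemma hasSource_meanDefect (ha : 0 < a) (f : HilbertL2 a) :
    HasSource a (meanDefect a f) (solve a (meanDefect a f)) :=
  hasSource_solve ha (Lp.memLp _) (integral_meanDefect ha f)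

/-- The function `x` with `(p x')' = mean f - f` and `x 0 = 0`, as a linear map of `f`. -/
noncomputable def solveLin (a : ℝ) (ha : 0 < a) : HilbertL2 a →ₗ[ℂ] HilbertL2 a where
  toFun f := ((hasSource_meanDefect ha f).mem_domainI ha).1.2.1.toLp _
  map_add' f g := by
    rw [← MemLp.toLp_add]
    refine MemLp.toLp_congr _ _ ?_
    filter_upwards [ae_restrict_mem measurableSet_Ioo] with t ht
    refine (hasSource_meanDefect ha (f + g)).eqOn ha
      ((hasSource_meanDefect ha f).add ha (hasSource_meanDefect ha g)) ?_ ?_ ht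
    · rw [map_add]
      exact Lp.coeFn_add _ _
    · simp [solve_zero]
  map_smul' c f := by
    rw [RingHom.id_apply, ← MemLp.toLp_const_smul]
    refine MemLp.toLp_congr _ _ ?_
    filter_upwards [ae_restrict_mem measurableSet_Ioo] with t ht
    refine (hasSource_meanDefect ha (c • f)).eqOn ha
      ((hasSource_meanDefect ha f).smul c) ?_ ?_ ht
    · rw [map_smul]
      exact Lp.coeFn_smul _ _
    · simp [solve_zero]

lemma coeFn_solveLin (ha : 0 < a) (f : HilbertL2 a) :
    (solveLin a ha f : ℝ → ℂ) =ᵐ[intervalMeasure a] solve a (meanDefect a f) :=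
  ((hasSource_meanDefect ha f).mem_domainI ha).1.2.1.coeFn_toLp

/-- Continuous functions on `[-a, a]` as elements of `L²`. -/
noncomputable def ofContinuous (a : ℝ) (ha : 0 < a)
    (u : BoundedContinuousFunction (Icc (-a) a) ℂ) : HilbertL2 a :=
  BoundedContinuousFunction.toLp 2 (intervalMeasure a) ℂ
    (u.compContinuous ⟨projIcc (-a) a (by linarith), continuous_projIcc⟩)

lemma continuous_ofContinuous (ha : 0 < a) : Continuous (ofContinuous a ha) :=
  (ContinuousLinearMap.continuous _).comp (BoundedContinuousFunction.continuous_compContinuous _)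

lemma coeFn_ofContinuous (ha : 0 < a) {u : BoundedContinuousFunction (Icc (-a) a) ℂ}
    (hu : ∀ t : Icc (-a) a, (t : ℝ) ∈ Ioo (-a) a → u t = x t) :
    (ofContinuous a ha u : ℝ → ℂ) =ᵐ[intervalMeasure a] x := by
  filter_upwards [BoundedContinuousFunction.coeFn_toLp 2 (intervalMeasure a) ℂ
    (u.compContinuous ⟨projIcc (-a) a (by linarith), continuous_projIcc⟩),
    ae_restrict_mem measurableSet_Ioo] with t h1 ht
  refine h1.trans ?_
  have hp : projIcc (-a) a (by linarith) t = ⟨t, Ioo_subset_Icc_self ht⟩ :=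
    projIcc_of_mem _ (Ioo_subset_Icc_self ht)
  simp only [BoundedContinuousFunction.compContinuous_apply, ContinuousMap.coe_mk, hp]
  exact hu ⟨t, Ioo_subset_Icc_self ht⟩ ht

/-- The continuous functions on `[-a, a]` with a prescribed bound and modulus of continuity. -/
def gaugeSet (a C : ℝ) : Set (BoundedContinuousFunction (Icc (-a) a) ℂ) :=
  {u | (∀ t, ‖u t‖ ≤ C) ∧ ∀ s t : Icc (-a) a, dist (u s) (u t) ≤ C * dist (gauge a s) (gauge a t)}

lemma isCompact_closure_gaugeSet (a C : ℝ) : IsCompact (closure (gaugeSet a C)) := by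
  refine BoundedContinuousFunction.arzela_ascoli (Metric.closedBall 0 C)
    (isCompact_closedBall 0 C) _ (fun u t hu => by simpa using hu.1 t) ?_
  intro t₀
  have hlim : Tendsto (fun t : Icc (-a) a => C * dist (gauge a t₀) (gauge a t)) (𝓝 t₀) (𝓝 0) := by
    have : Continuous fun t : Icc (-a) a => C * dist (gauge a t₀) (gauge a t) := by fun_prop
    simpa using this.tendsto t₀
  exact Metric.equicontinuousAt_of_continuity_modulus _ hlim _
    (Eventually.of_forall fun t u => u.2.2 t₀ t)

/-- Solutions for `f` in the unit ball share a bound and a modulus of continuity in `gauge`. They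
lie in a set of continuous functions with compact closure, and the inclusion into `L²` is
continuous. -/
lemma isCompactOperator_solveLin (ha : 0 < a) : IsCompactOperator (solveLin a ha) := by
  set N : ℝ := ‖meanDefect a‖ with hN
  set K : NNReal := lipschitzExtensionConstant ℂ * (a * N).toNNReal with hK
  obtain ⟨G, hG⟩ := (isCompact_Icc (a := -a) (b := a)).exists_bound_of_continuousOn
    (continuous_gauge a).continuousOn
  have hG0 : 0 ≤ G := (norm_nonneg _).trans (hG 0 ⟨by linarith, ha.le⟩)
  have hg0 : gauge a 0 = 0 := by simp [gauge]
  -- `K` is the common Lipschitz constant in `gauge`; `K * G` is a sup bound, since each solution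
  -- vanishes at `0`, where `gauge` is `0`.
  set C : ℝ := max K (K * G) with hC
  rw [isCompactOperator_iff_image_closedBall_subset_compact (solveLin a ha) (r := 1) one_pos]
  refine ⟨ofContinuous a ha '' closure (gaugeSet a C),
    (isCompact_closure_gaugeSet a C).image (continuous_ofContinuous ha), ?_⟩
  rintro _ ⟨f, hf, rfl⟩
  have hs := hasSource_meanDefect ha f
  obtain ⟨F, hF, hE⟩ := hs.exists_factor ha
  have hnorm : (eLpNorm (meanDefect a f) 2 (intervalMeasure a)).toReal ≤ N := by
    rw [← Lp.norm_def]
    refine ((meanDefect a).le_opNorm f).trans ?_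
    refine mul_le_of_le_one_right (norm_nonneg _) ?_
    simpa using hf
  have hF' : LipschitzWith K F := by
    refine hF.weaken ?_
    rw [hK]
    gcongr
  let u : BoundedContinuousFunction (Icc (-a) a) ℂ := BoundedContinuousFunction.mkOfCompact
    ⟨fun t => F (gauge a t), hF.continuous.comp
      ((continuous_gauge a).comp continuous_subtype_val)⟩
  have hF0 : F 0 = 0 := by
    have := hE 0 ⟨by linarith, ha⟩
    rwa [hg0, solve_zero] at this
  refine ⟨u, subset_closure ⟨fun t => ?_, fun s t => ?_⟩, ?_⟩
  · have h1 := hF'.dist_le_mul (gauge a t) 0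
    rw [hF0, dist_zero_right, dist_zero_right] at h1
    refine h1.trans (le_trans ?_ (le_max_right _ _))
    exact mul_le_mul_of_nonneg_left (hG t t.2) K.2
  · refine (hF'.dist_le_mul _ _).trans ?_
    exact mul_le_mul_of_nonneg_right (le_max_left _ _) dist_nonneg
  · refine Lp.ext (EventuallyEq.trans ?_ (coeFn_solveLin ha f).symm)
    exact coeFn_ofContinuous ha fun t ht => hE t ht

lemma memLp_sq_mul (f : HilbertL2 a) :
    MemLp (fun t : ℝ => ((t ^ 2 : ℝ) : ℂ) * f t) 2 (intervalMeasure a) := by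
  refine MemLp.of_le_mul (c := a ^ 2) (Lp.memLp f) ?_ ?_
  · exact (Measurable.aestronglyMeasurable (by fun_prop)).mul (Lp.memLp f).1
  · filter_upwards [ae_restrict_mem measurableSet_Ioo] with t ht
    rw [norm_mul, Complex.norm_real, Real.norm_of_nonneg (sq_nonneg t)]
    gcongr ?_ * _
    nlinarith [ht.1, ht.2]

/-- Multiplication by `t²`. -/
noncomputable def mulSq (a : ℝ) : HilbertL2 a →L[ℂ] HilbertL2 a :=
  LinearMap.mkContinuous
    { toFun := fun f => (memLp_sq_mul f).toLp _
      map_add' := fun f g => by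
        rw [← MemLp.toLp_add]
        refine MemLp.toLp_congr _ _ ?_
        filter_upwards [Lp.coeFn_add f g] with t ht
        simp only [ht, Pi.add_apply]
        ring
      map_smul' := fun c f => by
        rw [RingHom.id_apply, ← MemLp.toLp_const_smul]
        refine MemLp.toLp_congr _ _ ?_
        filter_upwards [Lp.coeFn_smul c f] with t ht
        simp only [ht, Pi.smul_apply, smul_eq_mul]
        ring } (a ^ 2) fun f => by
    refine Lp.norm_le_mul_norm_of_ae_le_mul ?_
    filter_upwards [(memLp_sq_mul f).coeFn_toLp, ae_restrict_mem measurableSet_Ioo] with t h1 ht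
    change ‖(memLp_sq_mul f).toLp _ t‖ ≤ _
    rw [h1, norm_mul, Complex.norm_real, Real.norm_of_nonneg (sq_nonneg t)]
    gcongr ?_ * _
    nlinarith [ht.1, ht.2]

lemma coeFn_mulSq (f : HilbertL2 a) :
    (mulSq a f : ℝ → ℂ) =ᵐ[intervalMeasure a] fun t => ((t ^ 2 : ℝ) : ℂ) * f t :=
  (memLp_sq_mul f).coeFn_toLp

/-- The inverse of `x ↦ -(p x')' + mean x`. -/
noncomputable def legendreInv (a : ℝ) (ha : 0 < a) : HilbertL2 a →L[ℂ] HilbertL2 a :=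
  let T := ContinuousLinearMap.mkOfIsCompactOperator (isCompactOperator_solveLin ha)
  T - (meanProj a) ∘L T + meanProj a

lemma legendreInv_apply (ha : 0 < a) (f : HilbertL2 a) :
    legendreInv a ha f = solveLin a ha f - meanProj a (solveLin a ha f) + meanProj a f := rfl

lemma isCompactOperator_legendreInv (ha : 0 < a) : IsCompactOperator (legendreInv a ha) :=
  ((isCompactOperator_solveLin ha).sub
    ((isCompactOperator_solveLin ha).clm_comp (meanProj a))).add (isCompactOperator_meanProj a)

/-- Taking means in the hypothesis gives mean zero for `g`, as `legendreInv` preserves means. So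
`meanDefect a g = -g`, and `f` is the solution with source `-g` up to an additive constant, which
does not affect the source. -/
lemma operatorI_apply_of_eq (ha : 0 < a) {f g : HilbertL2 a}
    (h : f = legendreInv a ha g + meanProj a f) :
    ∃ hd : f ∈ (operatorI a ha).domain, operatorI a ha ⟨f, hd⟩ = g + mulSq a f := by
  have hP : meanProj a g = 0 := by
    have h1 := congrArg (meanProj a) h
    rw [legendreInv_apply, map_add, map_add, map_sub, meanProj_meanProj ha, meanProj_meanProj ha,
      meanProj_meanProj ha, sub_self, zero_add] at h1
    exact left_eq_add.1 (h1.trans (add_comm _ _))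
  rw [legendreInv_apply, hP, add_zero, sub_add, ← map_sub] at h
  obtain ⟨c, hc⟩ := meanProj_ae_eq (solveLin a ha g - f)
  have hs := (hasSource_meanDefect ha g).add_const (-c)
  refine hs.operatorI_apply ha ?_ ?_
  · conv_lhs => rw [h]
    filter_upwards [Lp.coeFn_sub (solveLin a ha g) (meanProj a (solveLin a ha g - f)), hc,
      coeFn_solveLin ha g] with t h1 h2 h3
    rw [h1, Pi.sub_apply, h2, h3, sub_eq_add_neg]
  · have hf : (f : ℝ → ℂ) =ᵐ[intervalMeasure a] fun t => solve a (meanDefect a g) t + -c := by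
      conv_lhs => rw [h]
      filter_upwards [Lp.coeFn_sub (solveLin a ha g) (meanProj a (solveLin a ha g - f)), hc,
        coeFn_solveLin ha g] with t h1 h2 h3
      rw [h1, Pi.sub_apply, h2, h3, sub_eq_add_neg]
    have hD : meanDefect a g = -g := by simp [meanDefect, hP]
    have hD' : (meanDefect a g : ℝ → ℂ) =ᵐ[intervalMeasure a] -g := by
      rw [hD]
      exact Lp.coeFn_neg g
    filter_upwards [Lp.coeFn_add g (mulSq a f), coeFn_mulSq f, hf, hD'] with t h1 h2 h3 h4
    rw [h1, Pi.add_apply, h2, h4, h3, Pi.neg_apply, neg_neg]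

lemma operatorI_injective (ha : 0 < a) {f g : (operatorI a ha).domain}
    (h : operatorI a ha f = operatorI a ha g) : f = g := by
  by_contra hne
  have h0 : ((f - g : (operatorI a ha).domain) : HilbertL2 a) ≠ 0 := by
    simpa [sub_eq_zero] using fun hh => hne (Subtype.ext hh)
  obtain ⟨r, hr, he⟩ := form_pos ha (f - g) h0
  rw [LinearPMap.map_sub, h, sub_self, inner_zero_right] at he
  exact hr.ne (by exact_mod_cast he)

lemma exists_isPositiveCompactInverse (ha : 0 < a) :
    ∃ R, IsPositiveCompactInverse (operatorI a ha) R := by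
  set S := legendreInv a ha with hS
  set K : HilbertL2 a →L[ℂ] HilbertL2 a := meanProj a - S ∘L mulSq a with hK
  have hKc : IsCompactOperator K :=
    (isCompactOperator_meanProj a).sub ((isCompactOperator_legendreInv ha).comp_clm (mulSq a))
  -- A fixed vector `f` of `K` satisfies the hypothesis of `operatorI_apply_of_eq` with `g = -t² f`,
  -- so `f` is in the kernel of the operator, which is trivial.
  have hne : ¬ Module.End.HasEigenvalue (K : Module.End ℂ (HilbertL2 a)) 1 := by
    intro he
    obtain ⟨f, hf, h0⟩ := he.exists_hasEigenvector
    rw [Module.End.mem_eigenspace_iff, one_smul] at hf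
    have hf' : f = S (-mulSq a f) + meanProj a f := by
      conv_lhs => rw [← hf]
      simp [hK]
      abel
    obtain ⟨hd, hA⟩ := operatorI_apply_of_eq ha hf'
    rw [neg_add_cancel, ← (operatorI a ha).map_zero] at hA
    exact h0 (congrArg Subtype.val (operatorI_injective ha hA))
  have hu := (hKc.hasEigenvalue_or_mem_resolventSet one_ne_zero).resolve_left hne
  rw [_root_.spectrum.mem_resolventSet_iff, map_one] at hu
  obtain ⟨u, hu⟩ := hu
  set V : HilbertL2 a →L[ℂ] HilbertL2 a :=
    ((u⁻¹ : (HilbertL2 a →L[ℂ] HilbertL2 a)ˣ) : HilbertL2 a →L[ℂ] HilbertL2 a) with hV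
  have hV1 : ∀ f, V f - K (V f) = f := fun f => by
    have := congrArg (fun B : HilbertL2 a →L[ℂ] HilbertL2 a => B f) u.mul_inv
    simpa [hu] using this
  have happ : ∀ f, ∃ h : (V ∘L S) f ∈ (operatorI a ha).domain,
      operatorI a ha ⟨(V ∘L S) f, h⟩ = f := by
    intro f
    set g := (V ∘L S) f with hg
    have h1 : g - K g = S f := hV1 (S f)
    have h2 : g = S (f - mulSq a g) + meanProj a g := by
      rw [map_sub, ← h1]
      simp only [hK, sub_apply, ContinuousLinearMap.comp_apply]
      abel
    obtain ⟨hd, hA⟩ := operatorI_apply_of_eq ha h2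
    exact ⟨hd, by rw [hA, sub_add_cancel]⟩
  refine ⟨V ∘L S, (isCompactOperator_legendreInv ha).clm_comp V, happ, fun f => ?_, form_pos ha⟩
  obtain ⟨hd, hA⟩ := happ (operatorI a ha f)
  exact congrArg Subtype.val (operatorI_injective ha hA)

/-! ### Eigenfunctions -/

/-- `y` is a continuous function on the line which solves `L y = z y` on `(-a, a)`, in integrated
form, with `p y' → 0` at both endpoints. -/
structure IsEigenfunction (a : ℝ) (z : ℂ) (y : ℝ → ℂ) : Prop where
  continuous : Continuous y
  hasSource : HasSource a (fun t => (((t ^ 2 : ℝ) : ℂ) - z) * y t) y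

namespace IsEigenfunction

lemma continuous_source (h : IsEigenfunction a z y) :
    Continuous fun t : ℝ => (((t ^ 2 : ℝ) : ℂ) - z) * y t := by
  have := h.continuous
  fun_prop

lemma hasDerivAt_integral (h : IsEigenfunction a z y) (t : ℝ) :
    HasDerivAt (fun t => ∫ s in (-a)..t, (((s ^ 2 : ℝ) : ℂ) - z) * y s)
      ((((t ^ 2 : ℝ) : ℂ) - z) * y t) t :=
  intervalIntegral.integral_hasDerivAt_right (h.continuous_source.intervalIntegrable _ _)
    h.continuous_source.stronglyMeasurable.stronglyMeasurableAtFilter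
    h.continuous_source.continuousAt

lemma add_smul (ha : 0 < a) (h : IsEigenfunction a z x) (h' : IsEigenfunction a z y) (c : ℂ) :
    IsEigenfunction a z (x + c • y) := by
  refine ⟨h.continuous.add (h'.continuous.const_smul c), ?_⟩
  refine (h.hasSource.add ha (h'.hasSource.smul c)).congr_source ha (ae_of_all _ fun t => ?_)
  simp only [Pi.add_apply, Pi.smul_apply, smul_eq_mul]
  ring

lemma isFiniteSolution (h : IsEigenfunction a z y) : IsFiniteSolution a z y where
  differentiableAt t ht := (h.hasSource.hasDerivAt t ht).differentiableAt
  differentiableAt_deriv t ht := by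
    have he : deriv y =ᶠ[𝓝 t] fun t => (∫ s in (-a)..t, (((s ^ 2 : ℝ) : ℂ) - z) * y s) /
        ((1 - t ^ 2 / a ^ 2 : ℝ) : ℂ) := by
      filter_upwards [isOpen_Ioo.mem_nhds ht] with s hs using (h.hasSource.hasDerivAt s hs).deriv
    refine DifferentiableAt.congr_of_eventuallyEq ?_ he
    refine (h.hasDerivAt_integral t).differentiableAt.div ?_ (coe_one_sub_div_ne_zero ht)
    exact Complex.ofRealCLM.differentiableAt.comp t
      (show DifferentiableAt ℝ (fun s : ℝ => 1 - s ^ 2 / a ^ 2) t by fun_prop)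
  equation t ht := by
    have he : flux a y =ᶠ[𝓝 t] fun t => ∫ s in (-a)..t, (((s ^ 2 : ℝ) : ℂ) - z) * y s := by
      filter_upwards [isOpen_Ioo.mem_nhds ht] with s hs using h.hasSource.flux_eq hs
    rw [formalL, he.deriv_eq, (h.hasDerivAt_integral t).deriv]
    ring
  finite_left := ⟨_, (h.continuous.tendsto (-a)).mono_left nhdsWithin_le_nhds⟩
  finite_right := ⟨_, (h.continuous.tendsto a).mono_left nhdsWithin_le_nhds⟩

/-- An eigenfunction with vanishing Cauchy data at the origin vanishes. -/
lemma eqOn_zero (ha : 0 < a) (h : IsEigenfunction a z y) (h0 : y 0 = 0)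
    (h1 : ∫ s in (-a)..0, (((s ^ 2 : ℝ) : ℂ) - z) * y s = 0) : EqOn y 0 (Ioo (-a) a) := by
  intro t ht
  -- The coefficient `1 / p` is unbounded at the endpoints, so uniqueness is applied on a smaller
  -- interval containing `t` and `0`.
  obtain ⟨b, hb, hba⟩ := exists_between (max_lt (abs_lt.2 ht) ha)
  have hb0 : 0 < b := (le_max_right _ _).trans_lt hb
  have htb : t ∈ Ioo (-b) b := abs_lt.1 ((le_max_left _ _).trans_lt hb)
  have hsub : Ioo (-b) b ⊆ Ioo (-a) a := Ioo_subset_Ioo (by linarith) hba.le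
  set U : ℝ → ℂ := fun t => ∫ s in (-a)..t, (((s ^ 2 : ℝ) : ℂ) - z) * y s with hU
  -- The equation as a first order system for the pair `(y, p y')`.
  let V : ℝ → ℂ × ℂ → ℂ × ℂ := fun t q =>
    (((1 - t ^ 2 / a ^ 2 : ℝ) : ℂ)⁻¹ * q.2, (((t ^ 2 : ℝ) : ℂ) - z) * q.1)
  have hpb : 0 < 1 - b ^ 2 / a ^ 2 := one_sub_div_pos ⟨by linarith, hba⟩
  let K : NNReal := max (1 - b ^ 2 / a ^ 2)⁻¹.toNNReal (a ^ 2 + ‖z‖).toNNReal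
  have hLip : ∀ s ∈ Ioo (-b) b, LipschitzOnWith K (V s) univ := by
    intro s hs
    have hps := one_sub_div_pos (hsub hs)
    have hle : 1 - b ^ 2 / a ^ 2 ≤ 1 - s ^ 2 / a ^ 2 := by
      gcongr 1 - ?_ / _
      nlinarith [hs.1, hs.2]
    refine (LipschitzWith.prodMk ?_ ?_).lipschitzOnWith
    · refine LipschitzWith.of_dist_le_mul fun q r => ?_
      rw [dist_eq_norm, ← mul_sub, norm_mul, norm_inv, Complex.norm_real,
        Real.norm_of_nonneg hps.le, Real.coe_toNNReal _ (by positivity)]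
      refine mul_le_mul (inv_anti₀ hpb hle) ?_ (norm_nonneg _) (by positivity)
      rw [← dist_eq_norm]
      exact le_max_right _ _
    · refine LipschitzWith.of_dist_le_mul fun q r => ?_
      rw [dist_eq_norm, ← mul_sub, norm_mul, Real.coe_toNNReal _ (by positivity)]
      refine mul_le_mul ?_ ?_ (norm_nonneg _) (by positivity)
      · refine (norm_sub_le _ _).trans (add_le_add_left ?_ _)
        rw [Complex.norm_real, Real.norm_of_nonneg (sq_nonneg s)]
        nlinarith [(hsub hs).1, (hsub hs).2]
      · rw [← dist_eq_norm]
        exact le_max_left _ _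
  have key := ODE_solution_unique_of_mem_Ioo (v := V) (s := fun _ => univ)
    (f := fun s => (y s, U s)) (g := fun _ => (0, 0)) hLip ⟨by linarith, hb0⟩
    (fun s hs => ⟨by
      have e1 := h.hasSource.hasDerivAt s (hsub hs)
      rw [div_eq_inv_mul] at e1
      exact e1.prodMk (h.hasDerivAt_integral s), mem_univ _⟩)
    (fun s hs => ⟨by
      simp only [V, mul_zero]
      exact hasDerivAt_const s ((0 : ℂ), (0 : ℂ)), mem_univ _⟩)
    (by simp only [h0, hU, h1]) htb
  exact (Prod.mk.inj key).1

/-- The integrals are the values of `p x'` and `p y'` at `0`. The Wronskian is constant and tends to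
zero at `-a`, where both fluxes vanish and `x`, `y` stay bounded. -/
lemma wronskian_eq_zero (ha : 0 < a) (h : IsEigenfunction a z x) (h' : IsEigenfunction a z y) :
    (∫ s in (-a)..0, (((s ^ 2 : ℝ) : ℂ) - z) * x s) * y 0 =
      (∫ s in (-a)..0, (((s ^ 2 : ℝ) : ℂ) - z) * y s) * x 0 := by
  set U : ℝ → ℂ := fun t => ∫ s in (-a)..t, (((s ^ 2 : ℝ) : ℂ) - z) * x s with hU
  set V : ℝ → ℂ := fun t => ∫ s in (-a)..t, (((s ^ 2 : ℝ) : ℂ) - z) * y s with hV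
  have hd : ∀ t ∈ Ioo (-a) a, HasDerivAt (fun t => U t * y t - V t * x t) 0 t := by
    intro t ht
    have e := ((h.hasDerivAt_integral t).mul (h'.hasSource.hasDerivAt t ht)).sub
      ((h'.hasDerivAt_integral t).mul (h.hasSource.hasDerivAt t ht))
    refine e.congr_deriv ?_
    ring
  have hm : (0 : ℝ) ∈ Ioo (-a) a := ⟨by linarith, ha⟩
  have hconst : ∀ t ∈ Ioo (-a) a, U t * y t - V t * x t = U 0 * y 0 - V 0 * x 0 := fun t ht =>
    isOpen_Ioo.is_const_of_deriv_eq_zero isPreconnected_Ioo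
      (fun s hs => (hd s hs).differentiableAt.differentiableWithinAt)
      (fun s hs => (hd s hs).deriv) ht hm
  have hi := intervalIntegrable_of_memLp h.hasSource.memLp ha
  have hi' := intervalIntegrable_of_memLp h'.hasSource.memLp ha
  have hlim := ((tendsto_integral_left ha hi).mul
    ((h'.continuous.tendsto (-a)).mono_left (nhdsWithin_le_nhds (s := Ioi (-a))))).sub
    ((tendsto_integral_left ha hi').mul
    ((h.continuous.tendsto (-a)).mono_left (nhdsWithin_le_nhds (s := Ioi (-a)))))
  rw [zero_mul, zero_mul, sub_zero] at hlim
  have hlim' : Tendsto (fun _ : ℝ => U 0 * y 0 - V 0 * x 0) (𝓝[>] (-a)) (𝓝 0) := by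
    refine hlim.congr' ?_
    filter_upwards [Ioo_mem_nhdsGT (show -a < a by linarith)] with t ht using hconst t ht
  exact sub_eq_zero.1 (tendsto_nhds_unique tendsto_const_nhds hlim')

/-- Eigenfunctions for the same eigenvalue are proportional. -/
lemma exists_smul_eqOn (ha : 0 < a) (h : IsEigenfunction a z x) (h' : IsEigenfunction a z y)
    (hne : ¬ EqOn x 0 (Ioo (-a) a)) : ∃ c : ℂ, EqOn y (c • x) (Ioo (-a) a) := by
  have hW := h.wronskian_eq_zero ha h'
  have main : ∀ c : ℂ, y 0 = c * x 0 →
      (∫ s in (-a)..0, (((s ^ 2 : ℝ) : ℂ) - z) * y s) =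
        c * ∫ s in (-a)..0, (((s ^ 2 : ℝ) : ℂ) - z) * x s →
      EqOn y (c • x) (Ioo (-a) a) := by
    intro c e1 e2 t ht
    have hI : ∫ s in (-a)..0, (((s ^ 2 : ℝ) : ℂ) - z) * (y + (-c) • x) s = 0 := by
      rw [← intervalIntegral.integral_const_mul, ← sub_eq_zero,
        ← intervalIntegral.integral_sub (h'.continuous_source.intervalIntegrable _ _)
          ((h.continuous_source.intervalIntegrable _ _).const_mul c)] at e2
      rw [← e2]
      refine intervalIntegral.integral_congr fun s _ => ?_
      simp only [Pi.add_apply, Pi.smul_apply, smul_eq_mul]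
      ring
    have := (h'.add_smul ha h (-c)).eqOn_zero ha (by simp [e1]) hI ht
    simp only [Pi.add_apply, Pi.smul_apply, smul_eq_mul, Pi.zero_apply] at this ⊢
    linear_combination this
  by_cases hx0 : x 0 = 0
  · have hU0 : ∫ s in (-a)..0, (((s ^ 2 : ℝ) : ℂ) - z) * x s ≠ 0 := fun hh =>
      hne (h.eqOn_zero ha hx0 hh)
    rw [hx0, mul_zero] at hW
    -- The factor is the quotient of `p y'` by `p x'` at `0`; the vanishing Wronskian forces `y 0 =
    -- 0` as well.
    refine ⟨_ / _, main (_ / _) ?_ (div_mul_cancel₀ _ hU0).symm⟩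
    rw [(mul_eq_zero.1 hW).resolve_left hU0, hx0, mul_zero]
  · refine ⟨y 0 / x 0, main _ (div_mul_cancel₀ _ hx0).symm ?_⟩
    rw [div_mul_eq_mul_div, eq_div_iff hx0, ← hW]
    ring

lemma exists_mem_eigenspace (ha : 0 < a) (h : IsEigenfunction a z y) :
    ∃ f ∈ eigenspace (operatorI a ha) z, (f : ℝ → ℂ) =ᵐ[intervalMeasure a] y := by
  have hy := memLp_of_continuous_extension (a := a) h.continuous (fun t _ => rfl)
  refine ⟨hy.toLp y, ?_, hy.coeFn_toLp⟩
  refine h.hasSource.operatorI_apply ha hy.coeFn_toLp ?_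
  filter_upwards [Lp.coeFn_smul z (hy.toLp y), hy.coeFn_toLp] with t h1 h2
  rw [h1, Pi.smul_apply, h2, smul_eq_mul]
  ring

end IsEigenfunction

lemma exists_isEigenfunction (ha : 0 < a) {f : HilbertL2 a}
    (hf : f ∈ eigenspace (operatorI a ha) z) :
    ∃ y, IsEigenfunction a z y ∧ (f : ℝ → ℂ) =ᵐ[intervalMeasure a] y := by
  obtain ⟨hd, he⟩ := hf
  obtain ⟨w, x, h, hfx, hA⟩ := exists_source ha ⟨f, hd⟩
  obtain ⟨y, hy, hyx⟩ := h.exists_continuous_extension ha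
  have hyx' : y =ᵐ[intervalMeasure a] x := by
    filter_upwards [ae_restrict_mem measurableSet_Ioo] with t ht using hyx ht
  refine ⟨y, ⟨hy, (h.congr hyx).congr_source ha ?_⟩, hfx.trans hyx'.symm⟩
  rw [he] at hA
  filter_upwards [hA, Lp.coeFn_smul z f, hfx, hyx'] with t h1 h2 h3 h4
  rw [h2, Pi.smul_apply, h3, smul_eq_mul] at h1
  rw [h4]
  linear_combination h1

lemma eqOn_zero_of_ae_eq_zero (hy : ContinuousOn y (Ioo (-a) a))
    (h : y =ᵐ[intervalMeasure a] 0) : EqOn y 0 (Ioo (-a) a) :=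
  Measure.eqOn_open_of_ae_eq h isOpen_Ioo hy continuousOn_const

lemma finrank_eigenspace_eq_one (ha : 0 < a) (hz : HasEigenvalue (operatorI a ha) z) :
    Module.finrank ℂ (eigenspace (operatorI a ha) z) = 1 := by
  obtain ⟨f, hf, h0⟩ := hz
  obtain ⟨x, hx, hfx⟩ := exists_isEigenfunction ha hf
  have hne : ¬ EqOn x 0 (Ioo (-a) a) := fun hh => h0 (Lp.ext (by
    filter_upwards [hfx, ae_restrict_mem measurableSet_Ioo,
      Lp.coeFn_zero ℂ 2 (intervalMeasure a)] with t h1 h2 h3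
    rw [h1, hh h2, h3]))
  refine finrank_eq_one_iff'.2 ⟨⟨f, hf⟩, fun hh => h0 (congrArg Subtype.val hh), ?_⟩
  rintro ⟨g, hg⟩
  obtain ⟨y, hy, hgy⟩ := exists_isEigenfunction ha hg
  obtain ⟨c, hc⟩ := hx.exists_smul_eqOn ha hy hne
  refine ⟨c, Subtype.ext (Lp.ext ?_)⟩
  filter_upwards [hfx, hgy, ae_restrict_mem measurableSet_Ioo, Lp.coeFn_smul c f]
    with t h1 h2 h3 h4
  change (c • f : HilbertL2 a) t = g t
  rw [h4, h2, hc h3, Pi.smul_apply, Pi.smul_apply, h1]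

/-! ### Finite solutions -/

/-- If `x` and `p x'` have finite limits at `a`, then `p x'` tends to zero. -/
lemma flux_limit_right_eq_zero (ha : 0 < a) (hd : ∀ t ∈ Ioo (-a) a, DifferentiableAt ℝ x t)
    {c l : ℂ} (hx : Tendsto x (𝓝[<] a) (𝓝 l)) (hf : Tendsto (flux a x) (𝓝[<] a) (𝓝 c)) :
    c = 0 := by
  by_contra hc
  -- This real functional is positive at `c`, which reduces the divergence of `x` to a real
  -- monotonicity argument.
  let φ : ℂ →L[ℝ] ℝ := Complex.reCLM ∘L (ContinuousLinearMap.mul ℝ ℂ (starRingEnd ℂ c))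
  have hφ : ∀ u, φ u = (starRingEnd ℂ c * u).re := fun u => rfl
  have hφr : ∀ (r : ℝ) u, φ ((r : ℂ) * u) = r * φ u := fun r u => by
    rw [← Complex.real_smul, map_smul, smul_eq_mul]
  have hφc : 0 < φ c := by
    rw [hφ, mul_comm, Complex.mul_conj, Complex.ofReal_re]
    exact Complex.normSq_pos.2 hc
  set δ := φ c / 2 with hδ
  have hδ0 : 0 < δ := by positivity
  have hev : ∀ᶠ t in 𝓝[<] a, δ < φ (flux a x t) ∧ t ∈ Ioo 0 a :=
    (((φ.continuous.tendsto c).comp hf).eventually (lt_mem_nhds (half_lt_self hφc))).and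
      (Ioo_mem_nhdsLT ha)
  obtain ⟨b, hba, hb⟩ := (mem_nhdsLT_iff_exists_Ioo_subset' ha).1 hev
  -- From `p ≤ 2 (a - t) / a` and `φ (p x') > δ` follows `φ (x') ≥ κ / (a - t)`. So `φ x + κ log (a
  -- - t)` is nondecreasing near `a`, yet tends to `-∞` if `x` has a finite limit.
  set κ := δ * a / 2 with hκ
  have hκ0 : 0 < κ := by positivity
  have hderiv : ∀ t ∈ Ioo b a,
      HasDerivAt (fun t => φ (x t) + κ * Real.log (a - t))
        (φ (deriv x t) + κ * (-1 / (a - t))) t := by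
    intro t ht
    have h2 : a - t ≠ 0 := by linarith [ht.2]
    have hm : t ∈ Ioo (-a) a := ⟨by linarith [(hb ht).2.1], ht.2⟩
    exact (φ.hasFDerivAt.comp_hasDerivAt t (hd t hm).hasDerivAt).add
      ((((hasDerivAt_id t).const_sub a).log h2).const_mul κ)
  have hmono : MonotoneOn (fun t => φ (x t) + κ * Real.log (a - t)) (Ioo b a) := by
    refine monotoneOn_of_deriv_nonneg (convex_Ioo b a)
      (fun t ht => (hderiv t ht).continuousAt.continuousWithinAt) ?_ ?_
    · rw [interior_Ioo]
      exact fun t ht => (hderiv t ht).differentiableAt.differentiableWithinAt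
    · rw [interior_Ioo]
      intro t ht
      rw [(hderiv t ht).deriv]
      have h1 := (hb ht).1
      have h0 := (hb ht).2.1
      have h2 : 0 < a - t := by linarith [ht.2]
      rw [flux, hφr] at h1
      have hp : 1 - t ^ 2 / a ^ 2 = (a + t) * (a - t) / a ^ 2 := by
        field_simp
        ring
      have hpos : 0 < φ (deriv x t) := by
        have := one_sub_div_pos (a := a) ⟨by linarith, ht.2⟩
        exact pos_of_mul_pos_right (hδ0.trans h1) this.le
      have h3 : (1 - t ^ 2 / a ^ 2) * φ (deriv x t) ≤ 2 * (a - t) / a * φ (deriv x t) := by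
        refine mul_le_mul_of_nonneg_right ?_ hpos.le
        rw [hp, div_le_div_iff₀ (by positivity) ha]
        have : (a + t) * (a - t) * a ≤ (2 * a) * (a - t) * a := by
          gcongr
          linarith [ht.2]
        nlinarith
      have h4 : δ < 2 * (a - t) / a * φ (deriv x t) := h1.trans_le h3
      have h5 : κ / (a - t) ≤ φ (deriv x t) := by
        rw [div_le_iff₀ h2, hκ]
        have := mul_lt_mul_of_pos_right h4 ha
        rw [show 2 * (a - t) / a * φ (deriv x t) * a = 2 * (φ (deriv x t) * (a - t)) by
          field_simp] at this
        linarith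
      have h6 : κ * (-1 / (a - t)) = -(κ / (a - t)) := by ring
      rw [h6]
      linarith
  have hlog : Tendsto (fun t => κ * Real.log (a - t)) (𝓝[<] a) atBot := by
    refine Tendsto.const_mul_atBot hκ0 (Real.tendsto_log_nhdsGT_zero.comp ?_)
    refine tendsto_nhdsWithin_iff.2 ⟨?_, ?_⟩
    · have : Continuous fun t : ℝ => a - t := by fun_prop
      have := (this.tendsto a).mono_left (nhdsWithin_le_nhds (s := Iio a))
      rwa [sub_self] at this
    · filter_upwards [self_mem_nhdsWithin] with t ht
      exact sub_pos.2 (mem_Iio.1 ht)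
  have hbot := ((φ.continuous.tendsto l).comp hx).add_atBot hlog
  obtain ⟨t₀, ht₀⟩ := exists_between (mem_Iio.1 hba)
  obtain ⟨t, ht, htm⟩ := ((hbot.eventually_lt_atBot
    (φ (x t₀) + κ * Real.log (a - t₀))).and (Ioo_mem_nhdsLT ht₀.2)).exists
  exact absurd (hmono ht₀ ⟨ht₀.1.trans htm.1, htm.2⟩ htm.1.le) (not_le.2 ht)

lemma flux_limit_left_eq_zero (ha : 0 < a) (hd : ∀ t ∈ Ioo (-a) a, DifferentiableAt ℝ x t)
    {c l : ℂ} (hx : Tendsto x (𝓝[>] (-a)) (𝓝 l)) (hf : Tendsto (flux a x) (𝓝[>] (-a)) (𝓝 c)) :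
    c = 0 := by
  have hneg : Tendsto (fun b : ℝ => -b) (𝓝[<] a) (𝓝[>] (-a)) := tendsto_neg_nhdsLT
  have hflux : ∀ t, flux a (fun s => x (-s)) t = -flux a x (-t) := fun t => by
    rw [flux, flux, deriv_comp_neg, neg_sq]
    ring
  have := flux_limit_right_eq_zero (x := fun s => x (-s)) ha
    (fun t ht => DifferentiableAt.comp t (hd (-t) ⟨by linarith [ht.2], by linarith [ht.1]⟩)
      differentiable_neg.differentiableAt)
    (hx.comp hneg) (c := -c) (((hf.comp hneg).neg).congr fun t => (hflux t).symm)
  exact neg_eq_zero.1 this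

/-- By the equation, `p x'` differs by a constant from the primitive of a continuous function, so it
has limits at both ends. These limits must be zero: the left one removes the constant, the right one
makes the total integral vanish. -/
lemma IsFiniteSolution.exists_isEigenfunction (ha : 0 < a) (h : IsFiniteSolution a z x) :
    ∃ y, IsEigenfunction a z y ∧ EqOn y x (Ioo (-a) a) := by
  have hcont : ContinuousOn x (Ioo (-a) a) := fun t ht =>
    (h.differentiableAt t ht).continuousAt.continuousWithinAt
  obtain ⟨l, hl⟩ := h.finite_left
  obtain ⟨r, hr⟩ := h.finite_right
  have hle : -a ≤ a := by linarith
  set y : ℝ → ℂ := IccExtend hle ((Icc (-a) a).domRestrict (extendFrom (Ioo (-a) a) x)) with hy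
  have hyc : Continuous y :=
    (continuousOn_iff_continuous_domRestrict.1
      (continuousOn_Icc_extendFrom_Ioo hcont hl hr)).Icc_extend'
  have hyx : EqOn y x (Ioo (-a) a) := fun t ht => by
    rw [hy, IccExtend_of_mem _ _ (Ioo_subset_Icc_self ht)]
    exact extendFrom_extends hcont t ht
  have hwc : Continuous fun t : ℝ => (((t ^ 2 : ℝ) : ℂ) - z) * y t := by fun_prop
  set U : ℝ → ℂ := fun t => ∫ s in (-a)..t, (((s ^ 2 : ℝ) : ℂ) - z) * y s with hU
  have hUd : ∀ t, HasDerivAt U ((((t ^ 2 : ℝ) : ℂ) - z) * y t) t := fun t =>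
    intervalIntegral.integral_hasDerivAt_right (hwc.intervalIntegrable _ _)
      hwc.stronglyMeasurable.stronglyMeasurableAtFilter hwc.continuousAt
  have hd : ∀ t ∈ Ioo (-a) a, HasDerivAt (fun t => flux a x t - U t) 0 t := by
    intro t ht
    have e1 := (differentiableAt_flux (a := a) (h.differentiableAt_deriv t ht)).hasDerivAt
    refine (e1.sub (hUd t)).congr_deriv ?_
    have e2 := h.equation t ht
    rw [formalL] at e2
    rw [hyx ht]
    linear_combination -e2
  have hm : (0 : ℝ) ∈ Ioo (-a) a := ⟨by linarith, ha⟩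
  have hconst : ∀ t ∈ Ioo (-a) a, U t + (flux a x 0 - U 0) = flux a x t := fun t ht => by
    have : flux a x t - U t = flux a x 0 - U 0 :=
      isOpen_Ioo.is_const_of_deriv_eq_zero isPreconnected_Ioo
        (fun s hs => (hd s hs).differentiableAt.differentiableWithinAt)
        (fun s hs => (hd s hs).deriv) ht hm
    linear_combination -this
  have hwi : IntervalIntegrable (fun t : ℝ => (((t ^ 2 : ℝ) : ℂ) - z) * y t) volume (-a) a :=
    hwc.intervalIntegrable _ _
  have hc0 := flux_limit_left_eq_zero ha h.differentiableAt hl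
    (((tendsto_integral_left ha hwi).add_const (flux a x 0 - U 0)).congr' (by
      filter_upwards [Ioo_mem_nhdsGT (show -a < a by linarith)] with t ht using hconst t ht))
  have hc1 := flux_limit_right_eq_zero ha h.differentiableAt hr
    (((tendsto_integral_right ha hwi).add_const (flux a x 0 - U 0)).congr' (by
      filter_upwards [Ioo_mem_nhdsLT (show -a < a by linarith)] with t ht using hconst t ht))
  rw [zero_add] at hc0
  rw [hc0, add_zero] at hc1
  have hs : HasSource a (fun t => (((t ^ 2 : ℝ) : ℂ) - z) * y t) x := by
    refine ⟨memLp_of_continuous_extension hwc fun t _ => rfl, hc1, fun t ht => ?_⟩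
    have : U t = flux a x t := by rw [← hconst t ht, hc0, add_zero]
    change HasDerivAt x (U t / _) t
    rw [this, flux, mul_div_cancel_left₀ _ (coe_one_sub_div_ne_zero ht)]
    exact (h.differentiableAt t ht).hasDerivAt
  exact ⟨y, ⟨hyc, hs.congr hyx⟩, hyx⟩

lemma IsFiniteSolution.exists_mem_eigenspace (ha : 0 < a) (h : IsFiniteSolution a z x)
    (h0 : ∃ t ∈ Ioo (-a) a, x t ≠ 0) :
    ∃ f ∈ eigenspace (operatorI a ha) z, f ≠ 0 ∧ (f : ℝ → ℂ) =ᵐ[intervalMeasure a] x := by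
  obtain ⟨y, hy, hyx⟩ := h.exists_isEigenfunction ha
  obtain ⟨f, hf, hfy⟩ := hy.exists_mem_eigenspace ha
  have hyx' : y =ᵐ[intervalMeasure a] x := by
    filter_upwards [ae_restrict_mem measurableSet_Ioo] with t ht using hyx ht
  refine ⟨f, hf, ?_, hfy.trans hyx'⟩
  rintro rfl
  obtain ⟨t, ht, hne⟩ := h0
  refine hne ?_
  rw [← hyx ht]
  exact eqOn_zero_of_ae_eq_zero hy.continuous.continuousOn
    (hfy.symm.trans (Lp.coeFn_zero ℂ 2 (intervalMeasure a))) ht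

lemma exists_isFiniteSolution (ha : 0 < a) (hz : HasEigenvalue (operatorI a ha) z) :
    ∃ e : ℝ → ℂ, IsFiniteSolution a z e ∧ ∃ t ∈ Ioo (-a) a, e t ≠ 0 := by
  obtain ⟨f, hf, h0⟩ := hz
  obtain ⟨y, hy, hfy⟩ := exists_isEigenfunction ha hf
  refine ⟨y, hy.isFiniteSolution, ?_⟩
  by_contra! hcon
  refine h0 (Lp.ext ?_)
  filter_upwards [hfy, ae_restrict_mem measurableSet_Ioo,
    Lp.coeFn_zero ℂ 2 (intervalMeasure a)] with t h1 h2 h3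
  rw [h1, hcon t h2, h3, Pi.zero_apply]

/-! ### The Hilbert space is infinite dimensional -/

lemma memLp_polynomial (a : ℝ) (q : Polynomial ℂ) :
    MemLp (fun t : ℝ => q.eval (t : ℂ)) 2 (intervalMeasure a) :=
  memLp_of_continuous_extension (y := fun t : ℝ => q.eval (t : ℂ)) (by fun_prop) fun _ _ => rfl

/-- Polynomials embed: one that vanishes a.e. on the interval vanishes on all of it by continuity,
so has infinitely many roots. -/
lemma not_finiteDimensional_hilbertL2 (ha : 0 < a) : ¬ FiniteDimensional ℂ (HilbertL2 a) := by
  intro hfin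
  let φ : Polynomial ℂ →ₗ[ℂ] HilbertL2 a :=
    { toFun := fun q => (memLp_polynomial a q).toLp _
      map_add' := fun p q => by
        rw [← MemLp.toLp_add]
        exact MemLp.toLp_congr _ _ (ae_of_all _ fun t => by simp)
      map_smul' := fun c q => by
        rw [RingHom.id_apply, ← MemLp.toLp_const_smul]
        exact MemLp.toLp_congr _ _ (ae_of_all _ fun t => by simp) }
  have hinj : Function.Injective φ := by
    refine (injective_iff_map_eq_zero φ).2 fun q hq => ?_
    have h0 : (fun t : ℝ => q.eval (t : ℂ)) =ᵐ[intervalMeasure a] 0 := by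
      refine (memLp_polynomial a q).coeFn_toLp.symm.trans ?_
      change (φ q : ℝ → ℂ) =ᵐ[intervalMeasure a] 0
      rw [hq]
      exact Lp.coeFn_zero ℂ 2 (intervalMeasure a)
    have hz := eqOn_zero_of_ae_eq_zero (y := fun t : ℝ => q.eval (t : ℂ))
      (Continuous.continuousOn (by fun_prop)) h0
    refine Polynomial.eq_zero_of_infinite_isRoot q ?_
    refine ((Ioo_infinite (show -a < a by linarith)).image
      Complex.ofReal_injective.injOn).mono ?_
    rintro _ ⟨t, ht, rfl⟩
    exact hz ht
  exact Polynomial.not_finite (R := ℂ) (Module.Finite.of_injective φ hinj)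

end Prolate

theorem theorem4p3 (a : ℝ) (ha : 0 < a) :
    IsSelfAdjoint (Prolate.operatorI a ha) ∧
    Prolate.HasDiscreteSpectrum (Prolate.operatorI a ha) ∧
    (∃ μ : ℕ → ℝ, StrictMono μ ∧ (∀ n, 0 < μ n) ∧ Tendsto μ atTop atTop ∧
      Prolate.spectrum (Prolate.operatorI a ha) = Set.range (fun n => (μ n : ℂ)) ∧
      ∀ n, Module.finrank ℂ (Prolate.eigenspace (Prolate.operatorI a ha) (μ n : ℂ)) = 1) ∧
    (∀ z : ℂ, Prolate.HasEigenvalue (Prolate.operatorI a ha) z ↔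
      ∃ e : ℝ → ℂ, Prolate.IsFiniteSolution a z e ∧ ∃ t ∈ Set.Ioo (-a) a, e t ≠ 0) ∧
    (∀ (z : ℂ) (e : ℝ → ℂ), Prolate.IsFiniteSolution a z e →
      (∃ t ∈ Set.Ioo (-a) a, e t ≠ 0) →
      ∃ f ∈ Prolate.eigenspace (Prolate.operatorI a ha) z, f ≠ 0 ∧
        (f : ℝ → ℂ) =ᵐ[Prolate.intervalMeasure a] e) := by
  obtain ⟨R, hR⟩ := Prolate.exists_isPositiveCompactInverse ha
  refine ⟨hR.isSelfAdjoint, hR.hasDiscreteSpectrum, ?_, fun z => ⟨fun hz => ?_, ?_⟩,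
    fun z e he h0 => he.exists_mem_eigenspace ha h0⟩
  · obtain ⟨μ, hmono, hrange, hlim⟩ := Prolate.exists_strictMono_range_eq
      (hR.infinite_eigenvalues (Prolate.not_finiteDimensional_hilbertL2 ha))
      hR.finite_eigenvalues_le
    have hμ : ∀ n, Prolate.HasEigenvalue (Prolate.operatorI a ha) (μ n : ℂ) := fun n => by
      have : μ n ∈ {r : ℝ | Prolate.HasEigenvalue (Prolate.operatorI a ha) r} := by
        rw [← hrange]
        exact mem_range_self n
      exact this
    refine ⟨μ, hmono, fun n => ?_, hlim, ?_, fun n => Prolate.finrank_eigenspace_eq_one ha (hμ n)⟩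
    · obtain ⟨r, hr, hr'⟩ := hR.eigenvalue_pos (hμ n)
      rw [Complex.ofReal_injective hr']
      exact hr
    · rw [hR.spectrum_eq]
      ext z
      constructor
      · intro hz
        obtain ⟨r, -, rfl⟩ := hR.eigenvalue_pos hz
        obtain ⟨n, rfl⟩ : r ∈ range μ := by
          rw [hrange]
          exact hz
        exact ⟨n, rfl⟩
      · rintro ⟨n, rfl⟩
        exact hμ n
  · exact Prolate.exists_isFiniteSolution ha hz
  · rintro ⟨e, he, h0⟩
    obtain ⟨f, hf, hne, -⟩ := he.exists_mem_eigenspace ha h0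
    exact ⟨f, hf, hne⟩
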